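/- Let $N\ge 2$, $0<a<b$, $A=\{x\in\mathbb{R}^N : a<|x|<b\}$, and let $m\ge 1$ be an integer. For $p>1$ let $v_p=v_p(r)$, $r=|x|$, be the radial classical solution of $$-\Delta v=|v|^{p-1}v \ \text{ in } A,\qquad v=0 \ \text{ on } \partial A,$$ that has precisely $m$ nodal zones (connected components of $\{x\in A: v(x)\neq 0\}$) and satisfies $v_p'(a)>0$. Let $\lambda_m$ be the $m$-th eigenvalue, in increasing order, among the eigenvalues of $-\Delta$ in $A$ with Dirichlet boundary conditions that have a radial eigenfunction, and let $\psi_m=\psi_m(r)$ be the corresponding radial eigenfunction, normalized by $\|\psi_m\|_\infty=1$ and $\psi_m'(a)>0$. Then, as $p\to 1^+$, $$\|v_p\|_\infty^{p-1}\to\lambda_m \qquad\text{and}\qquad \frac{v_p}{\|v_p\|_\infty}\to\psi_m \ \text{ in } C^2(A),$$ that is, the functions $v_p/\|v_p\|_\infty$ and their first and second derivatives converge uniformly on $A$ to $\psi_m$ and its corresponding derivatives. -/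

import Mathlib

open Filter Topology Set
open scoped InnerProductSpace Laplacian

noncomputable section

/-- The open annulus `{x ∈ ℝᴺ : a < |x| < b}`. -/
def annulus (N : ℕ) (a b : ℝ) : Set (EuclideanSpace ℝ (Fin N)) :=
  {x | a < ‖x‖ ∧ ‖x‖ < b}

/-- The radial function on `ℝᴺ` with profile `f`, i.e. `x ↦ f |x|`. -/
def radialLift (N : ℕ) (f : ℝ → ℝ) : EuclideanSpace ℝ (Fin N) → ℝ :=
  fun x => f ‖x‖

/-- The sup norm of a function on a set (used here for bounded functions only). -/
def supNormOn {E : Type*} (s : Set E) (u : E → ℝ) : ℝ :=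
  sSup ((fun x => |u x|) '' s)

/-- `u` is a classical solution, in `C²(A) ∩ C(closure A)`, of the Dirichlet problem
`-Δ u = g u` in `A`, `u = 0` on the boundary of `A`. -/
structure IsClassicalDirichletSolution {N : ℕ} (A : Set (EuclideanSpace ℝ (Fin N)))
    (g : ℝ → ℝ) (u : EuclideanSpace ℝ (Fin N) → ℝ) : Prop where
  contDiffOn : ContDiffOn ℝ 2 u A
  continuousOn : ContinuousOn u (closure A)
  equation : ∀ x ∈ A, -(Δ u) x = g (u x)
  boundary : ∀ x ∈ frontier A, u x = 0

/-- The number of nodal zones of `u` in `A`: the number of connected components of the open set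
where `u` does not vanish (it is `0` when that number is infinite). -/
def nodalZoneCount {N : ℕ} (A : Set (EuclideanSpace ℝ (Fin N)))
    (u : EuclideanSpace ℝ (Fin N) → ℝ) : ℕ :=
  Nat.card (ConnectedComponents {x : EuclideanSpace ℝ (Fin N) // x ∈ A ∧ u x ≠ 0})

/-- `v = v(r)` is the profile of a radial solution of `-Δ v = |v|^(p-1) v` in the annulus, with
`v = 0` on the boundary, with precisely `m` nodal zones and with `v'(a) > 0`. -/
structure IsRadialNodalSolution (N : ℕ) (a b : ℝ) (m : ℕ) (p : ℝ) (v : ℝ → ℝ) : Prop where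
  solves : IsClassicalDirichletSolution (annulus N a b) (fun t => |t| ^ (p - 1) * t)
    (radialLift N v)
  nodalZones : nodalZoneCount (annulus N a b) (radialLift N v) = m
  deriv_pos : 0 < derivWithin v (Icc a b) a

/-- `ψ = ψ(r)` is the profile of a radial Dirichlet eigenfunction of `-Δ` in the annulus, with
eigenvalue `μ`. -/
structure IsRadialEigenfunction (N : ℕ) (a b μ : ℝ) (ψ : ℝ → ℝ) : Prop where
  solves : IsClassicalDirichletSolution (annulus N a b) (fun t => μ * t) (radialLift N ψ)
  nontrivial : ∃ x ∈ annulus N a b, radialLift N ψ x ≠ 0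

/-- The set of radial Dirichlet eigenvalues of `-Δ` in the annulus. -/
def radialEigenvalues (N : ℕ) (a b : ℝ) : Set ℝ :=
  {μ | ∃ ψ : ℝ → ℝ, IsRadialEigenfunction N a b μ ψ}

/-- `μ` is the `m`-th radial Dirichlet eigenvalue in increasing order, starting from `m = 1`
(radial eigenvalues are simple, so that no multiplicity has to be counted). -/
def IsRadialEigenvalueNumber (N : ℕ) (a b : ℝ) (m : ℕ) (μ : ℝ) : Prop :=
  μ ∈ radialEigenvalues N a b ∧ {κ ∈ radialEigenvalues N a b | κ ≤ μ}.encard = m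

/-- Convergence in `C²(A)`, `A` open: uniform convergence on all of `A` of the functions and of
their derivatives of order one and two. -/
def TendstoInC2 {ι : Type*} {N : ℕ} (u : ι → EuclideanSpace ℝ (Fin N) → ℝ)
    (w : EuclideanSpace ℝ (Fin N) → ℝ) (l : Filter ι) (A : Set (EuclideanSpace ℝ (Fin N))) :
    Prop :=
  ∀ k : ℕ, k ≤ 2 →
    TendstoUniformlyOn (fun i => iteratedFDeriv ℝ k (u i)) (iteratedFDeriv ℝ k w) l A

end

/-! ### One-sided Grönwall estimate and antiderivatives on a compact interval -/

/-! Put `w = v_p / ‖v_p‖_∞` and `lam = ‖v_p‖_∞ ^ (p - 1)`. The profile `w` then solves a radial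
equation that is linear once the potential `c = lam |w| ^ (p - 1)` is frozen. Its Prüfer angle,
started at `0`, crosses multiples of `π` only upwards, so having `m` nodal zones means ending at `m
π` (`nodalZoneCount_radialLift`). For a constant potential `μ` the final angle `Θ μ b` is continuous
and strictly increasing in `μ` and is below `π` at `μ = 0`, so `λ_m` is characterized by `Θ λ_m b =
m π` (`IsRadialEigenvalueNumber.angle_eq`).

Since `|w| ≤ 1`, `c ≤ lam`, and comparison of angles gives `lam ≥ λ_m`
(`IsNormalizedNodal.eigenvalue_le`). Conversely let `lam ≥ μ > λ_m`. Energy monotonicity bounds the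
amplitude of `(w, r ^ (N - 1) w')` below by some `κ > 0` (`exists_le_sq_add_sq`), whence `|w| ≥ κ
|sin θ|`. The angle equation weights the potential by `sin² θ`, which compensates the failure of
`|w| ^ (p - 1) → 1` at the zeros of `w`. Thus `Θ μ b ≤ m π + O(p - 1)` (`exists_angle_le`),
impossible for `p` near `1` because `Θ μ b > m π`. No a priori upper bound on `lam` is needed.

Once `lam → λ_m`, `w` solves the linear equation up to a uniformly small error. Stability of the
initial value problem puts it near a multiple of `ψ_m`, and the sup norms force the multiple to tend
to `1` (`exists_abs_sub_le`). The equation itself controls second derivatives. -/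

lemma HasDerivWithinAt.Ici_of_Icc {f : ℝ → ℝ} {f' a b t : ℝ}
    (h : HasDerivWithinAt f f' (Icc a b) t) (ht : t ∈ Ico a b) :
    HasDerivWithinAt f f' (Ici t) t :=
  h.mono_of_mem_nhdsWithin
    (mem_of_superset (Icc_mem_nhdsGE ht.2) (Icc_subset_Icc_left ht.1))

lemma le_exp_of_deriv_le {f f' : ℝ → ℝ} {a b L δ : ℝ}
    (hf : ∀ t ∈ Icc a b, HasDerivWithinAt f (f' t) (Icc a b) t) (ha : f a ≤ 0)
    (hL : 0 ≤ L) (hδ : 0 ≤ δ) (h : ∀ t ∈ Icc a b, 0 ≤ f t → f' t ≤ L * f t + δ) :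
    ∀ t ∈ Icc a b, f t ≤ δ * Real.exp ((L + 1) * (t - a)) := by
  intro t ht
  -- The rate `L + 1` and the constant `δ' > δ` make the barrier strictly steeper than `f` at any
  -- contact point; `δ'` is sent to `δ` at the end.
  have key : ∀ δ' > δ, f t ≤ δ' * Real.exp ((L + 1) * (t - a)) := by
    intro δ' hδ'
    have hB : ∀ x, HasDerivAt (fun x => δ' * Real.exp ((L + 1) * (x - a)))
        (δ' * (Real.exp ((L + 1) * (x - a)) * (L + 1))) x := by
      intro x
      have := (((hasDerivAt_id x).sub_const a).const_mul (L + 1)).exp.const_mul δ'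
      simpa using this
    refine image_le_of_deriv_right_lt_deriv_boundary
      (fun x hx => (hf x hx).continuousWithinAt)
      (fun x hx => (hf x (Ico_subset_Icc_self hx)).Ici_of_Icc hx) ?_ hB ?_ ht
    · simp only [sub_self, mul_zero, Real.exp_zero, mul_one]; linarith
    · intro x hx hfx
      have h1 : 1 ≤ Real.exp ((L + 1) * (x - a)) :=
        Real.one_le_exp (mul_nonneg (by linarith) (by linarith [hx.1]))
      have h2 := h x (Ico_subset_Icc_self hx) (by
        rw [hfx]; exact mul_nonneg (hδ.trans hδ'.le) (Real.exp_pos _).le)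
      rw [hfx] at h2
      nlinarith
  have hE := Real.exp_pos ((L + 1) * (t - a))
  rw [← div_le_iff₀ hE]
  refine le_of_forall_gt_imp_ge_of_dense fun δ' hδ' => ?_
  rw [div_le_iff₀ hE]
  exact key δ' hδ'

/-- The Picard operator of a field independent of the state is an antiderivative, differentiable up
to both endpoints. -/
lemma exists_hasDerivWithinAt_Icc {k : ℝ → ℝ} {a b : ℝ} (hab : a ≤ b)
    (hk : ContinuousOn k (Icc a b)) :
    ∃ K : ℝ → ℝ, K a = 0 ∧ ∀ t ∈ Icc a b, HasDerivWithinAt K (k t) (Icc a b) t := by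
  refine ⟨ODE.picard (fun t _ => k t) a 0 (fun _ => (0 : ℝ)), by simp, fun t ht => ?_⟩
  refine ODE.hasDerivWithinAt_picard_Icc (u := univ) (left_mem_Icc.2 hab) ?_
    continuousOn_const (fun _ _ => mem_univ _) 0 ht
  exact hk.comp continuousOn_fst fun x hx => hx.1

/-! ### Sturm–Liouville systems and Prüfer angles -/

/-- `w` and `g = P w'` solve `(P w')' = - P c w` on `[a, b]`. -/
structure IsSturmSystem (a b : ℝ) (P c w g : ℝ → ℝ) : Prop where
  deriv_fst : ∀ t ∈ Icc a b, HasDerivWithinAt w (g t / P t) (Icc a b) t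
  deriv_snd : ∀ t ∈ Icc a b, HasDerivWithinAt g (-(P t * c t * w t)) (Icc a b) t

/-- The right-hand side of the Prüfer equation of `(P w')' = - P c w`. -/
noncomputable def pruferField (P c : ℝ → ℝ) (t x : ℝ) : ℝ :=
  Real.cos x ^ 2 / P t + P t * c t * Real.sin x ^ 2

/-- `θ` is the Prüfer angle, vanishing at `a`, of `(P w')' = - P c w` on `[a, b]`. -/
structure IsPruferAngle (a b : ℝ) (P c θ : ℝ → ℝ) : Prop where
  left : θ a = 0
  deriv : ∀ t ∈ Icc a b, HasDerivWithinAt θ (pruferField P c t (θ t)) (Icc a b) t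

lemma abs_sin_sq_sub_le (x y : ℝ) : |Real.sin x ^ 2 - Real.sin y ^ 2| ≤ |x - y| := by
  have : Real.sin x ^ 2 - Real.sin y ^ 2 = Real.sin (x + y) * Real.sin (x - y) := by
    rw [Real.sin_add, Real.sin_sub]
    nlinarith [Real.sin_sq_add_cos_sq x, Real.sin_sq_add_cos_sq y]
  rw [this, abs_mul]
  calc _ ≤ 1 * |Real.sin (x - y)| := by gcongr; exact Real.abs_sin_le_one _
    _ ≤ |x - y| := by rw [one_mul]; exact Real.abs_sin_le_abs

/-- With `cos² = 1 - sin²` the state enters only through `(P c - 1 / P) sin²`, and `sin²` is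
1-Lipschitz. -/
lemma abs_pruferField_sub_le {P c : ℝ → ℝ} {t p₀ p₁ k : ℝ} (hp₀ : 0 < p₀) (h₀ : p₀ ≤ P t)
    (h₁ : P t ≤ p₁) (hc : |c t| ≤ k) (x y : ℝ) :
    |pruferField P c t x - pruferField P c t y| ≤ (1 / p₀ + p₁ * k) * |x - y| := by
  have e : pruferField P c t x - pruferField P c t y =
      (P t * c t - 1 / P t) * (Real.sin x ^ 2 - Real.sin y ^ 2) := by
    simp only [pruferField, Real.cos_sq']; ring
  have hP : 0 < P t := hp₀.trans_le h₀
  rw [e, abs_mul]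
  have hk : 0 ≤ k := (abs_nonneg _).trans hc
  have hp₁ : 0 ≤ p₁ := hP.le.trans h₁
  refine mul_le_mul ?_ ?_ (abs_nonneg _) (by positivity)
  · have h2 : 1 / P t ≤ 1 / p₀ := one_div_le_one_div_of_le hp₀ h₀
    calc _ ≤ |P t * c t| + |1 / P t| := abs_sub _ _
      _ = P t * |c t| + 1 / P t := by
        rw [abs_mul, abs_of_pos hP, abs_of_pos (one_div_pos.2 hP)]
      _ ≤ p₁ * k + 1 / p₀ := by gcongr
      _ = _ := add_comm _ _
  · exact abs_sin_sq_sub_le x y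

lemma abs_pruferField_le {P c : ℝ → ℝ} {t p₀ p₁ k : ℝ} (hp₀ : 0 < p₀) (h₀ : p₀ ≤ P t)
    (h₁ : P t ≤ p₁) (hc : |c t| ≤ k) (x : ℝ) :
    |pruferField P c t x| ≤ 1 / p₀ + p₁ * k := by
  have hP : 0 < P t := hp₀.trans_le h₀
  have hk : 0 ≤ k := (abs_nonneg _).trans hc
  have hp₁ : 0 ≤ p₁ := hP.le.trans h₁
  have h2 : 1 / P t ≤ 1 / p₀ := one_div_le_one_div_of_le hp₀ h₀
  calc |pruferField P c t x| ≤ |Real.cos x ^ 2 / P t| + |P t * c t * Real.sin x ^ 2| := abs_add_le _ _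
    _ = Real.cos x ^ 2 * (1 / P t) + P t * |c t| * Real.sin x ^ 2 := by
      rw [abs_mul, abs_mul, abs_div, abs_of_pos hP, abs_of_nonneg (sq_nonneg (Real.cos x)),
        abs_of_nonneg (sq_nonneg (Real.sin x))]; ring
    _ ≤ 1 * (1 / p₀) + p₁ * k * 1 := by
      have := Real.cos_sq_le_one x
      have := Real.sin_sq_le_one x
      gcongr
    _ = _ := by ring

lemma exists_bounds {P : ℝ → ℝ} {a b : ℝ} (hab : a ≤ b) (hP : ContinuousOn P (Icc a b))
    (hpos : ∀ t ∈ Icc a b, 0 < P t) :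
    ∃ p₀ p₁, 0 < p₀ ∧ ∀ t ∈ Icc a b, p₀ ≤ P t ∧ P t ≤ p₁ := by
  obtain ⟨x, hx, hx'⟩ := isCompact_Icc.exists_isMinOn (nonempty_Icc.2 hab) hP
  obtain ⟨y, hy, hy'⟩ := isCompact_Icc.exists_isMaxOn (nonempty_Icc.2 hab) hP
  exact ⟨P x, P y, hpos x hx, fun t ht => ⟨hx' ht, hy' ht⟩⟩

lemma exists_abs_bound {c : ℝ → ℝ} {a b : ℝ} (hc : ContinuousOn c (Icc a b)) :
    ∃ k, 0 ≤ k ∧ ∀ t ∈ Icc a b, |c t| ≤ k := by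
  obtain ⟨k, hk⟩ := isCompact_Icc.exists_bound_of_continuousOn hc
  exact ⟨max k 0, le_max_right _ _, fun t ht => (hk t ht).trans (le_max_left _ _)⟩

theorem exists_isPruferAngle {P c : ℝ → ℝ} {a b : ℝ} (hab : a ≤ b)
    (hP : ContinuousOn P (Icc a b)) (hpos : ∀ t ∈ Icc a b, 0 < P t)
    (hc : ContinuousOn c (Icc a b)) : ∃ θ, IsPruferAngle a b P c θ := by
  obtain ⟨p₀, p₁, hp₀, hp⟩ := exists_bounds hab hP hpos
  obtain ⟨k, hk0, hk⟩ := exists_abs_bound hc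
  have hp₁ : 0 < p₁ :=
    (hpos a (left_mem_Icc.2 hab)).trans_le (hp a (left_mem_Icc.2 hab)).2
  set B : NNReal := ⟨1 / p₀ + p₁ * k, by positivity⟩
  -- The field is globally bounded and Lipschitz, both with constant `B`, so a ball of radius `B (b
  -- - a)` carries the solution across the whole interval.
  have : IsPicardLindelof (pruferField P c) (⟨a, left_mem_Icc.2 hab⟩ : Icc a b) (0 : ℝ)
      (B * ⟨b - a, by linarith⟩) 0 B B := by
    refine ⟨fun t ht => ?_, fun x _ => ?_, fun t ht x _ => ?_, ?_⟩
    · refine LipschitzOnWith.of_dist_le_mul fun x _ y _ => ?_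
      exact abs_pruferField_sub_le hp₀ (hp t ht).1 (hp t ht).2 (hk t ht) x y
    · unfold pruferField
      exact (continuousOn_const.div hP fun t ht => (hpos t ht).ne').add
        ((hP.mul hc).mul continuousOn_const)
    · exact abs_pruferField_le hp₀ (hp t ht).1 (hp t ht).2 (hk t ht) x
    · simp only [sub_self, NNReal.coe_zero, sub_zero]
      rw [max_eq_left (by linarith)]
      exact le_rfl
  obtain ⟨θ, h0, h1⟩ := this.exists_eq_forall_mem_Icc_hasDerivWithinAt₀
  exact ⟨θ, h0, h1⟩

namespace IsPruferAngle

variable {a b : ℝ} {P c c₁ c₂ θ α β : ℝ → ℝ}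

lemma continuousOn (h : IsPruferAngle a b P c θ) : ContinuousOn θ (Icc a b) :=
  fun t ht => (h.deriv t ht).continuousWithinAt

/-- Quantitative comparison of the Prüfer angles of two potentials. -/
theorem le_add {p₀ p₁ k δ : ℝ} (hα : IsPruferAngle a b P c₁ α) (hβ : IsPruferAngle a b P c₂ β)
    (hp₀ : 0 < p₀) (hp : ∀ t ∈ Icc a b, p₀ ≤ P t ∧ P t ≤ p₁) (hk : ∀ t ∈ Icc a b, |c₁ t| ≤ k)
    (hδ : 0 ≤ δ) (h : ∀ t ∈ Icc a b, P t * (c₁ t - c₂ t) * Real.sin (β t) ^ 2 ≤ δ) :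
    ∀ t ∈ Icc a b,
      α t ≤ β t + δ * Real.exp ((1 / p₀ + p₁ * k + 1) * (t - a)) := by
  intro t ht
  have hp₁ : 0 ≤ p₁ := (hp₀.le.trans (hp t ht).1).trans (hp t ht).2
  have hk0 : 0 ≤ k := (abs_nonneg _).trans (hk t ht)
  have := le_exp_of_deriv_le (f := fun t => α t - β t)
    (fun t ht => (hα.deriv t ht).sub (hβ.deriv t ht)) (by simp [hα.left, hβ.left])
    (L := 1 / p₀ + p₁ * k) (by positivity) hδ (fun t ht hs => ?_) t ht
  · linarith
  -- The state is first moved from `α` to `β` with `c₁` fixed, then the potential is changed at `β`.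
  -- Hence only `c₁` needs a bound.
  · have h1 := abs_pruferField_sub_le hp₀ (hp t ht).1 (hp t ht).2 (hk t ht) (α t) (β t)
    rw [abs_of_nonneg hs] at h1
    have h2 : pruferField P c₁ t (β t) - pruferField P c₂ t (β t) =
        P t * (c₁ t - c₂ t) * Real.sin (β t) ^ 2 := by simp only [pruferField]; ring
    have h3 := le_abs_self (pruferField P c₁ t (α t) - pruferField P c₁ t (β t))
    linarith [h t ht]

theorem le_of_le (hab : a ≤ b) (hP : ContinuousOn P (Icc a b)) (hpos : ∀ t ∈ Icc a b, 0 < P t)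
    (hc₁ : ContinuousOn c₁ (Icc a b)) (hα : IsPruferAngle a b P c₁ α)
    (hβ : IsPruferAngle a b P c₂ β) (h : ∀ t ∈ Icc a b, c₁ t ≤ c₂ t) :
    ∀ t ∈ Icc a b, α t ≤ β t := by
  obtain ⟨p₀, p₁, hp₀, hp⟩ := exists_bounds hab hP hpos
  obtain ⟨k, hk0, hk⟩ := exists_abs_bound hc₁
  intro t ht
  have := hα.le_add hβ hp₀ hp hk le_rfl (fun t ht => ?_) t ht
  · simpa using this
  · exact mul_nonpos_of_nonpos_of_nonneg
      (mul_nonpos_of_nonneg_of_nonpos (hpos t ht).le (by linarith [h t ht])) (sq_nonneg _)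

/-- The Prüfer angle crosses the multiples of `π` only upwards. -/
theorem lt_of_le (h : IsPruferAngle a b P c θ) (hpos : ∀ t ∈ Icc a b, 0 < P t) (j : ℤ) {r s : ℝ}
    (hr : r ∈ Icc a b) (hs : s ∈ Icc a b) (hrs : r < s) (hj : j * Real.pi ≤ θ r) :
    j * Real.pi < θ s := by
  have hsub : Icc r b ⊆ Icc a b := Icc_subset_Icc_left hr.1
  -- At a multiple of `π` the sine vanishes and the angle has slope `1 / P > 0`, whatever the
  -- potential.
  have hval : ∀ t ∈ Icc a b, θ t = j * Real.pi → pruferField P c t (θ t) = 1 / P t := by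
    intro t ht e
    have h1 : Real.sin (θ t) = 0 := by rw [e]; exact Real.sin_int_mul_pi j
    have h2 : Real.cos (θ t) ^ 2 = 1 := by rw [Real.cos_sq', h1]; simp
    simp [pruferField, h1, h2]
  have hle : ∀ t ∈ Icc r b, j * Real.pi ≤ θ t := by
    intro t ht
    refine image_le_of_deriv_right_lt_deriv_boundary' (f := fun _ => (j : ℝ) * Real.pi)
      (f' := fun _ => 0) (B' := fun t => pruferField P c t (θ t)) continuousOn_const
      (fun _ _ => hasDerivWithinAt_const _ _ _) hj (h.continuousOn.mono hsub)
      (fun x hx => (h.deriv x (hsub (Ico_subset_Icc_self hx))).Ici_of_Icc ⟨hr.1.trans hx.1, hx.2⟩)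
      (fun x hx e => ?_) ht
    have hx' := hsub (Ico_subset_Icc_self hx)
    rw [hval x hx' e.symm]
    exact one_div_pos.2 (hpos x hx')
  -- If the level were attained at `s`, left difference quotients would be nonpositive, against the
  -- slope `1 / P s`.
  refine lt_of_le_of_ne (hle s ⟨hrs.le, hs.2⟩) fun e => ?_
  have hd : HasDerivWithinAt θ (1 / P s) (Icc r s) s := by
    have := (h.deriv s hs).mono (Icc_subset_Icc hr.1 hs.2 : Icc r s ⊆ Icc a b)
    rwa [hval s hs e.symm] at this
  have hd' : HasDerivWithinAt θ (1 / P s) (Iio s) s := hd.mono_of_mem_nhdsWithin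
    (mem_of_superset (Ioo_mem_nhdsLT hrs) Ioo_subset_Icc_self)
  rw [hasDerivWithinAt_iff_tendsto_slope' (by simp)] at hd'
  have h0 : 1 / P s ≤ 0 := by
    refine le_of_tendsto hd' ?_
    filter_upwards [Ioo_mem_nhdsLT hrs] with t ht
    rw [slope_def_field, ← e]
    exact div_nonpos_of_nonneg_of_nonpos (sub_nonneg.2 (hle t ⟨ht.1.le, ht.2.le.trans hs.2⟩))
      (by linarith [ht.2])
  exact absurd h0 (not_le.2 (one_div_pos.2 (hpos s hs)))

lemma pos (h : IsPruferAngle a b P c θ) (hpos : ∀ t ∈ Icc a b, 0 < P t) :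
    ∀ t ∈ Ioc a b, 0 < θ t := by
  intro t ht
  simpa using h.lt_of_le hpos 0 (left_mem_Icc.2 (ht.1.le.trans ht.2)) (Ioc_subset_Icc_self ht)
    ht.1 (by simp [h.left])

lemma exists_mem_Ioo (hab : a < b) (h : IsPruferAngle a b P c θ)
    (hpos : ∀ t ∈ Icc a b, 0 < P t) : ∃ t ∈ Ioo a b, 0 < θ t ∧ θ t < Real.pi := by
  have h1 : ContinuousWithinAt θ (Ioo a b) a :=
    (h.continuousOn a (left_mem_Icc.2 hab.le)).mono Ioo_subset_Icc_self
  have h2 : ∀ᶠ t in 𝓝[Ioo a b] a, θ t < Real.pi :=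
    h1.eventually_lt_const (by rw [h.left]; exact Real.pi_pos)
  have : (𝓝[Ioo a b] a).NeBot := by
    rw [nhdsWithin_Ioo_eq_nhdsGT hab]; infer_instance
  obtain ⟨t, h3, h4⟩ := (h2.and self_mem_nhdsWithin).exists
  exact ⟨t, h4, h.pos hpos t (Ioo_subset_Ioc_self h4), h3⟩

/-- For a constant potential, the Prüfer angle at the right end strictly increases with the
potential. -/
theorem right_lt_right {μ₁ μ₂ : ℝ} (hab : a < b) (hP : ContinuousOn P (Icc a b))
    (hpos : ∀ t ∈ Icc a b, 0 < P t) (hα : IsPruferAngle a b P (fun _ => μ₁) α)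
    (hβ : IsPruferAngle a b P (fun _ => μ₂) β) (h : μ₁ < μ₂) : α b < β b := by
  have hle := le_of_le hab.le hP hpos continuousOn_const hα hβ fun _ _ => h.le
  refine lt_of_le_of_ne (hle b (right_mem_Icc.2 hab.le)) fun e => ?_
  obtain ⟨p₀, p₁, hp₀, hp⟩ := exists_bounds hab.le hP hpos
  set L := 1 / p₀ + p₁ * |μ₁| with hLdef
  have hdiff : ∀ t ∈ Icc a b, P t * (μ₂ - μ₁) * Real.sin (β t) ^ 2 - L * (β t - α t) ≤
      pruferField P (fun _ => μ₂) t (β t) - pruferField P (fun _ => μ₁) t (α t) := by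
    intro t ht
    have h1 := abs_pruferField_sub_le (c := fun _ => μ₁) hp₀ (hp t ht).1 (hp t ht).2 le_rfl
      (β t) (α t)
    rw [abs_of_nonneg (sub_nonneg.2 (hle t ht))] at h1
    have h2 : pruferField P (fun _ => μ₂) t (β t) - pruferField P (fun _ => μ₁) t (β t) =
        P t * (μ₂ - μ₁) * Real.sin (β t) ^ 2 := by simp only [pruferField]; ring
    have h3 := neg_abs_le (pruferField P (fun _ => μ₁) t (β t) -
      pruferField P (fun _ => μ₁) t (α t))
    linarith
  -- The integrating factor makes `F` nondecreasing and nonnegative. Equality of the angles at `b`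
  -- gives `F = 0` throughout; subtracting the two equations then forces `sin β = 0`, although `β`
  -- takes values in `(0, π)`.
  set F : ℝ → ℝ := fun t => Real.exp (L * t) * (β t - α t) with hF
  have hFd : ∀ t ∈ Icc a b, HasDerivWithinAt F (Real.exp (L * t) * L * (β t - α t) +
      Real.exp (L * t) * (pruferField P (fun _ => μ₂) t (β t) -
        pruferField P (fun _ => μ₁) t (α t))) (Icc a b) t := by
    intro t ht
    have h1 : HasDerivAt (fun t => Real.exp (L * t)) (Real.exp (L * t) * L) t := by
      simpa using ((hasDerivAt_id t).const_mul L).exp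
    exact h1.hasDerivWithinAt.mul ((hβ.deriv t ht).sub (hα.deriv t ht))
  have hmono : MonotoneOn F (Icc a b) := by
    refine monotoneOn_of_hasDerivWithinAt_nonneg (convex_Icc a b)
      (fun t ht => (hFd t ht).continuousWithinAt)
      (fun t ht => (hFd t (interior_subset ht)).mono interior_subset) fun t ht => ?_
    have ht' := interior_subset ht
    have h4 : 0 ≤ P t * (μ₂ - μ₁) * Real.sin (β t) ^ 2 :=
      mul_nonneg (mul_nonneg (hpos t ht').le (by linarith)) (sq_nonneg _)
    have := mul_nonneg (Real.exp_pos (L * t)).le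
      (show 0 ≤ L * (β t - α t) + (pruferField P (fun _ => μ₂) t (β t) -
        pruferField P (fun _ => μ₁) t (α t)) by linarith [hdiff t ht'])
    linarith
  have hzero : ∀ t ∈ Icc a b, β t = α t := by
    intro t ht
    have h1 := hmono ht (right_mem_Icc.2 hab.le) ht.2
    have h2 : F b = 0 := by simp [hF, e]
    rw [h2] at h1
    have h3 : β t - α t ≤ 0 := nonpos_of_mul_nonpos_right h1 (Real.exp_pos _)
    linarith [hle t ht]
  have hsin : ∀ t ∈ Icc a b, Real.sin (β t) ^ 2 ≤ 0 := by
    intro t ht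
    have h1 : HasDerivWithinAt β (pruferField P (fun _ => μ₁) t (α t)) (Icc a b) t :=
      (hα.deriv t ht).congr hzero (hzero t ht)
    have h2 := (uniqueDiffOn_Icc hab t ht).eq_deriv _ h1 (hβ.deriv t ht)
    have h3 := hdiff t ht
    rw [hzero t ht] at h2 h3 ⊢
    have h4 : 0 < P t * (μ₂ - μ₁) := mul_pos (hpos t ht) (by linarith)
    exact nonpos_of_mul_nonpos_right (by linarith) h4
  obtain ⟨t, ht, h0, hlt⟩ := hβ.exists_mem_Ioo hab hpos
  have h5 := Real.sin_pos_of_pos_of_lt_pi h0 hlt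
  exact absurd (hsin t (Ioo_subset_Icc_self ht)) (not_le.2 (pow_pos h5 2))

/-- Applying `le_add` in both directions gives a local Lipschitz estimate; near `μ` both potentials
are bounded by `|μ| + 1`. -/
lemma continuous_right {Θ : ℝ → ℝ → ℝ} (hab : a ≤ b) (hP : ContinuousOn P (Icc a b))
    (hpos : ∀ t ∈ Icc a b, 0 < P t) (hΘ : ∀ μ, IsPruferAngle a b P (fun _ => μ) (Θ μ)) :
    Continuous fun μ => Θ μ b := by
  obtain ⟨p₀, p₁, hp₀, hp⟩ := exists_bounds hab hP hpos
  have hb : b ∈ Icc a b := right_mem_Icc.2 hab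
  have hp₁ : 0 ≤ p₁ := (hpos b hb).le.trans (hp b hb).2
  have key : ∀ K μ ν : ℝ, |μ| ≤ K →
      Θ μ b ≤ Θ ν b + p₁ * |μ - ν| * Real.exp ((1 / p₀ + p₁ * K + 1) * (b - a)) := by
    intro K μ ν hμ
    refine (hΘ μ).le_add (hΘ ν) hp₀ hp (fun _ _ => hμ) (by positivity) (fun t ht => ?_) b hb
    calc P t * (μ - ν) * Real.sin (Θ ν t) ^ 2 ≤ P t * |μ - ν| * 1 :=
          mul_le_mul (mul_le_mul_of_nonneg_left (le_abs_self _) (hpos t ht).le)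
            (Real.sin_sq_le_one _) (sq_nonneg _) (mul_nonneg (hpos t ht).le (abs_nonneg _))
      _ ≤ p₁ * |μ - ν| := by
          rw [mul_one]; exact mul_le_mul_of_nonneg_right (hp t ht).2 (abs_nonneg _)
  rw [continuous_iff_continuousAt]
  intro μ
  rw [ContinuousAt, tendsto_iff_dist_tendsto_zero]
  set E := Real.exp ((1 / p₀ + p₁ * (|μ| + 1) + 1) * (b - a))
  have hlim : Tendsto (fun ν => p₁ * |ν - μ| * E) (𝓝 μ) (𝓝 0) := by
    have : Continuous fun ν => p₁ * |ν - μ| * E := by fun_prop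
    simpa using this.tendsto μ
  refine squeeze_zero' (Eventually.of_forall fun _ => dist_nonneg) ?_ hlim
  filter_upwards [Metric.ball_mem_nhds μ one_pos] with ν hν
  have hν' : |ν| ≤ |μ| + 1 := by
    have h1 : |ν - μ| < 1 := hν
    have h2 : |ν| - |μ| ≤ |ν - μ| := abs_sub_abs_le_abs_sub ν μ
    linarith
  rw [Real.dist_eq, abs_le]
  have h1 := key (|μ| + 1) ν μ hν'
  have h2 := key (|μ| + 1) μ ν (by linarith)
  rw [abs_sub_comm μ ν] at h2
  constructor <;> linarith

/-- For zero potential `π / 2` is an equilibrium, which the angle cannot cross. -/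
lemma right_lt_pi_of_zero (hab : a ≤ b) (hP : ContinuousOn P (Icc a b))
    (hpos : ∀ t ∈ Icc a b, 0 < P t) (h : IsPruferAngle a b P (fun _ => 0) θ) :
    θ b < Real.pi := by
  obtain ⟨p₀, p₁, hp₀, hp⟩ := exists_bounds hab hP hpos
  have hf : ∀ t, pruferField P (fun _ => 0) t (Real.pi / 2) = 0 := by simp [pruferField]
  have hb := right_mem_Icc.2 hab
  have := le_exp_of_deriv_le (f := fun t => θ t - Real.pi / 2)
    (fun t ht => (h.deriv t ht).sub_const _) (by simp [h.left]; positivity)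
    (L := 1 / p₀ + p₁ * 0) (by rw [mul_zero]; positivity) le_rfl (fun t ht hs => ?_) b hb
  · simp only [zero_mul] at this
    linarith [Real.pi_pos]
  · have h1 := abs_pruferField_sub_le (c := fun _ => 0) hp₀ (hp t ht).1 (hp t ht).2 (k := 0)
      (by simp) (θ t) (Real.pi / 2)
    rw [abs_of_nonneg hs, hf] at h1
    linarith [le_abs_self (pruferField P (fun _ => 0) t (θ t) - 0)]

end IsPruferAngle

/-! ### Linear theory -/

namespace IsSturmSystem

variable {a b : ℝ} {P c w g w₁ g₁ θ : ℝ → ℝ}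

lemma const_mul (h : IsSturmSystem a b P c w g) (k : ℝ) :
    IsSturmSystem a b P c (fun t => k * w t) (fun t => k * g t) where
  deriv_fst t ht := by
    simpa [mul_div_assoc] using (h.deriv_fst t ht).const_mul k
  deriv_snd t ht := ((h.deriv_snd t ht).const_mul k).congr_deriv (by ring)

lemma continuousOn_fst (h : IsSturmSystem a b P c w g) : ContinuousOn w (Icc a b) :=
  fun t ht => (h.deriv_fst t ht).continuousWithinAt

lemma continuousOn_snd (h : IsSturmSystem a b P c w g) : ContinuousOn g (Icc a b) :=
  fun t ht => (h.deriv_snd t ht).continuousWithinAt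

end IsSturmSystem

/-- Stability estimate for the perturbed system `z' = h / P`, `h' = - P c z + e`. -/
theorem sq_add_sq_le_of_sturm_perturbation {a b p₀ p₁ k δ : ℝ} {P c z h e : ℝ → ℝ}
    (hp₀ : 0 < p₀) (hp : ∀ t ∈ Icc a b, p₀ ≤ P t ∧ P t ≤ p₁) (hk : ∀ t ∈ Icc a b, |c t| ≤ k)
    (hz : ∀ t ∈ Icc a b, HasDerivWithinAt z (h t / P t) (Icc a b) t)
    (hh : ∀ t ∈ Icc a b, HasDerivWithinAt h (-(P t * c t * z t) + e t) (Icc a b) t)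
    (he : ∀ t ∈ Icc a b, |e t| ≤ δ) (hza : z a = 0) (hha : h a = 0) :
    ∀ t ∈ Icc a b, z t ^ 2 + h t ^ 2 ≤ δ ^ 2 * Real.exp ((1 / p₀ + p₁ * k + 2) * (t - a)) := by
  intro t ht
  have hp₁ : 0 ≤ p₁ := (hp₀.le.trans (hp t ht).1).trans (hp t ht).2
  have hk0 : 0 ≤ k := (abs_nonneg _).trans (hk t ht)
  have hd : ∀ t ∈ Icc a b, HasDerivWithinAt (fun t => z t ^ 2 + h t ^ 2)
      (2 * z t * (h t / P t) + 2 * h t * (-(P t * c t * z t) + e t)) (Icc a b) t := by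
    intro t ht
    refine (((hz t ht).pow 2).add ((hh t ht).pow 2)).congr_deriv ?_
    push_cast; ring
  have := le_exp_of_deriv_le hd (by simp [hza, hha]) (L := 1 / p₀ + p₁ * k + 1) (by positivity)
    (sq_nonneg δ) (fun t ht _ => ?_) t ht
  · convert this using 3; ring
  · have hP : 0 < P t := hp₀.trans_le (hp t ht).1
    have h1 : 2 * |z t| * |h t| ≤ z t ^ 2 + h t ^ 2 := by
      rw [← sq_abs (z t), ← sq_abs (h t)]; exact two_mul_le_add_sq _ _
    have h2 : 2 * z t * (h t / P t) ≤ 1 / p₀ * (z t ^ 2 + h t ^ 2) := by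
      calc 2 * z t * (h t / P t) ≤ |2 * z t * (h t / P t)| := le_abs_self _
        _ = 1 / P t * (2 * |z t| * |h t|) := by
          rw [abs_mul, abs_mul, abs_div, abs_of_pos hP, abs_two]; ring
        _ ≤ 1 / p₀ * (z t ^ 2 + h t ^ 2) :=
          mul_le_mul (one_div_le_one_div_of_le hp₀ (hp t ht).1) h1 (by positivity) (by positivity)
    have h3 : 2 * h t * -(P t * c t * z t) ≤ p₁ * k * (z t ^ 2 + h t ^ 2) := by
      calc 2 * h t * -(P t * c t * z t) ≤ |2 * h t * -(P t * c t * z t)| := le_abs_self _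
        _ = P t * |c t| * (2 * |z t| * |h t|) := by
          rw [abs_mul, abs_neg, abs_mul, abs_mul, abs_mul, abs_of_pos hP, abs_two]; ring
        _ ≤ p₁ * k * (z t ^ 2 + h t ^ 2) :=
          mul_le_mul (mul_le_mul (hp t ht).2 (hk t ht) (abs_nonneg _) hp₁) h1 (by positivity)
            (by positivity)
    have h4 : 2 * h t * e t ≤ h t ^ 2 + δ ^ 2 := by
      have := sq_le_sq' (neg_le_of_abs_le (he t ht)) (le_of_abs_le (he t ht))
      nlinarith [sq_nonneg (h t - e t)]
    nlinarith [sq_nonneg (z t)]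

namespace IsSturmSystem

variable {a b : ℝ} {P c w g w₁ g₁ θ : ℝ → ℝ}

theorem eqOn (hab : a ≤ b) (hP : ContinuousOn P (Icc a b)) (hpos : ∀ t ∈ Icc a b, 0 < P t)
    (hc : ContinuousOn c (Icc a b)) (h : IsSturmSystem a b P c w g)
    (h₁ : IsSturmSystem a b P c w₁ g₁) (hw : w a = w₁ a) (hg : g a = g₁ a) :
    ∀ t ∈ Icc a b, w t = w₁ t ∧ g t = g₁ t := by
  obtain ⟨p₀, p₁, hp₀, hp⟩ := exists_bounds hab hP hpos
  obtain ⟨k, hk0, hk⟩ := exists_abs_bound hc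
  intro t ht
  have := sq_add_sq_le_of_sturm_perturbation (z := fun t => w t - w₁ t)
    (h := fun t => g t - g₁ t) (e := fun _ => 0) (δ := 0) hp₀ hp hk
    (fun t ht => ((h.deriv_fst t ht).sub (h₁.deriv_fst t ht)).congr_deriv (by ring))
    (fun t ht => ((h.deriv_snd t ht).sub (h₁.deriv_snd t ht)).congr_deriv (by ring))
    (by simp) (by simp [hw]) (by simp [hg]) t ht
  simp only [ne_eq, OfNat.ofNat_ne_zero, not_false_eq_true, zero_pow, zero_mul] at this
  have h1 : (w t - w₁ t) ^ 2 = 0 := by nlinarith [sq_nonneg (w t - w₁ t), sq_nonneg (g t - g₁ t)]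
  have h2 : (g t - g₁ t) ^ 2 = 0 := by nlinarith [sq_nonneg (w t - w₁ t), sq_nonneg (g t - g₁ t)]
  exact ⟨sub_eq_zero.1 (pow_eq_zero_iff two_ne_zero |>.1 h1),
    sub_eq_zero.1 (pow_eq_zero_iff two_ne_zero |>.1 h2)⟩

/-- Solutions in terms of the Prüfer angle. -/
theorem exists_of_isPruferAngle (hab : a ≤ b) (hP : ContinuousOn P (Icc a b))
    (hpos : ∀ t ∈ Icc a b, 0 < P t) (hc : ContinuousOn c (Icc a b))
    (hθ : IsPruferAngle a b P c θ) :
    ∃ S : ℝ → ℝ, (∀ t, 0 < S t) ∧ S a = 1 ∧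
      IsSturmSystem a b P c (fun t => S t * Real.sin (θ t)) (fun t => S t * Real.cos (θ t)) := by
  -- The amplitude must satisfy `S' / S = (1 / P - P c) sin θ cos θ`, so `S = exp (-K)`.
  obtain ⟨K, hK0, hK⟩ := exists_hasDerivWithinAt_Icc
    (k := fun t => (P t * c t - 1 / P t) * (Real.sin (θ t) * Real.cos (θ t))) hab
    (((hP.mul hc).sub (continuousOn_const.div hP fun t ht => (hpos t ht).ne')).mul
      ((Real.continuous_sin.comp_continuousOn hθ.continuousOn).mul
        (Real.continuous_cos.comp_continuousOn hθ.continuousOn)))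
  have hS : ∀ t ∈ Icc a b, HasDerivWithinAt (fun t => Real.exp (-K t))
      (Real.exp (-K t) * -((P t * c t - 1 / P t) * (Real.sin (θ t) * Real.cos (θ t))))
      (Icc a b) t := fun t ht => (hK t ht).neg.exp
  have hcs : ∀ t, Real.cos (θ t) ^ 2 = 1 - Real.sin (θ t) ^ 2 := fun t => Real.cos_sq' _
  refine ⟨fun t => Real.exp (-K t), fun t => Real.exp_pos _, by simp [hK0], ?_, ?_⟩
  · intro t ht
    refine ((hS t ht).mul (hθ.deriv t ht).sin).congr_deriv ?_
    have h1 : Real.exp (-K t) * Real.cos (θ t) / P t = Real.exp (-K t) * Real.cos (θ t) *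
      (Real.cos (θ t) ^ 2 + Real.sin (θ t) ^ 2) / P t := by rw [hcs]; ring
    rw [h1, pruferField]; ring
  · intro t ht
    refine ((hS t ht).mul (hθ.deriv t ht).cos).congr_deriv ?_
    have h1 : -(P t * c t * (Real.exp (-K t) * Real.sin (θ t))) =
      -(P t * c t * (Real.exp (-K t) * Real.sin (θ t))) *
      (Real.cos (θ t) ^ 2 + Real.sin (θ t) ^ 2) := by rw [hcs]; ring
    rw [h1, pruferField]; ring

/-- By uniqueness, the solution is `g a` times the one built from the angle; positivity of `g a`
makes the amplitude positive. -/
theorem exists_eq_mul_sin (hab : a ≤ b) (hP : ContinuousOn P (Icc a b))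
    (hpos : ∀ t ∈ Icc a b, 0 < P t) (hc : ContinuousOn c (Icc a b))
    (hθ : IsPruferAngle a b P c θ) (h : IsSturmSystem a b P c w g) (hw : w a = 0)
    (hg : 0 < g a) :
    ∃ S : ℝ → ℝ, (∀ t, 0 < S t) ∧
      ∀ t ∈ Icc a b, w t = S t * Real.sin (θ t) ∧ g t = S t * Real.cos (θ t) := by
  obtain ⟨S, hS, hSa, hsys⟩ := exists_of_isPruferAngle hab hP hpos hc hθ
  refine ⟨fun t => g a * S t, fun t => mul_pos hg (hS t), fun t ht => ?_⟩
  have := h.eqOn hab hP hpos hc (hsys.const_mul (g a)) (by simp [hw, hθ.left])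
    (by simp [hSa, hθ.left]) t ht
  simp only [mul_assoc]
  exact this

end IsSturmSystem

/-! ### Nodal zones of a radial function -/

/-- Polar coordinates: the set is the image of `I` times the unit sphere, which is connected because
`N ≥ 2`. -/
lemma isPreconnected_radial {N : ℕ} (hN : 2 ≤ N) {I : Set ℝ} (hI : IsPreconnected I)
    (hpos : ∀ r ∈ I, 0 < r) : IsPreconnected {x : EuclideanSpace ℝ (Fin N) | ‖x‖ ∈ I} := by
  have hS : IsPreconnected (Metric.sphere (0 : EuclideanSpace ℝ (Fin N)) 1) := by
    refine isPreconnected_sphere ?_ 0 1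
    rw [← Module.finrank_eq_rank, finrank_euclideanSpace_fin]
    exact_mod_cast hN
  have h := (hI.prod hS).image (fun q : ℝ × EuclideanSpace ℝ (Fin N) => q.1 • q.2)
    (by fun_prop)
  convert h using 1
  ext x
  constructor
  · intro hx
    have hx0 : 0 < ‖x‖ := hpos _ hx
    refine ⟨(‖x‖, ‖x‖⁻¹ • x), ⟨hx, ?_⟩, ?_⟩
    · simp [norm_smul, hx0.ne']
    · simp [smul_smul, hx0.ne']
  · rintro ⟨⟨r, y⟩, ⟨hr, hy⟩, rfl⟩
    have hr0 := hpos r hr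
    have hy' : ‖y‖ = 1 := by simpa using hy
    simpa [norm_smul, hy', abs_of_pos hr0] using hr

lemma exists_norm_eq_of_two_le {N : ℕ} (hN : 2 ≤ N) {r : ℝ} (hr : 0 ≤ r) :
    ∃ x : EuclideanSpace ℝ (Fin N), ‖x‖ = r :=
  ⟨EuclideanSpace.single ⟨0, by omega⟩ r, by simp [hr]⟩

/-- Where `w ≠ 0`, `⌊θ / π⌋` is locally constant. Its fibres are connected shells and its values are
exactly `0, …, k - 1`, so it enumerates the components. -/
theorem nodalZoneCount_radialLift {N : ℕ} (hN : 2 ≤ N) {a b : ℝ} (ha : 0 < a) (hab : a < b)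
    {P c θ w : ℝ → ℝ} (hpos : ∀ t ∈ Icc a b, 0 < P t) (hθ : IsPruferAngle a b P c θ) {k : ℕ}
    (hk : θ b = k * Real.pi) (hw : ∀ t ∈ Ioo a b, w t = 0 ↔ Real.sin (θ t) = 0) :
    nodalZoneCount (annulus N a b) (radialLift N w) = k := by
  have hpi := Real.pi_pos
  set U := {x : EuclideanSpace ℝ (Fin N) // x ∈ annulus N a b ∧ radialLift N w x ≠ 0}
  have hIoo : ∀ x : U, ‖x.1‖ ∈ Ioo a b := fun x => x.2.1
  have hcont : Continuous fun x : U => θ ‖x.1‖ / Real.pi := by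
    refine Continuous.div_const ?_ _
    exact hθ.continuousOn.comp_continuous (by fun_prop) fun x => Ioo_subset_Icc_self (hIoo x)
  have hne : ∀ x : U, ∀ n : ℤ, θ ‖x.1‖ / Real.pi ≠ n := by
    intro x n e
    refine x.2.2 ((hw _ (hIoo x)).2 ?_)
    rw [div_eq_iff hpi.ne'] at e
    rw [e]; exact Real.sin_int_mul_pi n
  set f : U → ℤ := fun x => ⌊θ ‖x.1‖ / Real.pi⌋ with hf
  have hfib : ∀ (n : ℤ) (x : U), f x = n ↔
      (n : ℝ) < θ ‖x.1‖ / Real.pi ∧ θ ‖x.1‖ / Real.pi < n + 1 := by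
    intro n x
    rw [hf, Int.floor_eq_iff]
    exact ⟨fun h => ⟨lt_of_le_of_ne h.1 (hne x n).symm, h.2⟩, fun h => ⟨h.1.le, h.2⟩⟩
  have hfc : Continuous f := by
    rw [continuous_discrete_rng]
    intro n
    have : f ⁻¹' {n} = (fun x : U => θ ‖x.1‖ / Real.pi) ⁻¹' Ioo (n : ℝ) (n + 1) := by
      ext x; exact hfib n x
    rw [this]
    exact isOpen_Ioo.preimage hcont
  have hpre : ∀ n : ℤ, IsPreconnected (f ⁻¹' {n}) := by
    intro n
    refine (Topology.IsEmbedding.subtypeVal (p := fun x => x ∈ annulus N a b ∧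
      radialLift N w x ≠ 0)).isInducing.isPreconnected_image.1 ?_
    set I : Set ℝ := {r | r ∈ Ioo a b ∧ n * Real.pi < θ r ∧ θ r < (n + 1) * Real.pi} with hI
    -- Upward-only crossing makes this level set an interval.
    have hIc : IsPreconnected I := by
      refine Set.OrdConnected.isPreconnected ⟨?_⟩
      rintro r ⟨hr, hr1, hr2⟩ s ⟨hs, hs1, hs2⟩ t ⟨hrt, hts⟩
      have ht : t ∈ Ioo a b := ⟨hr.1.trans_le hrt, hts.trans_lt hs.2⟩
      refine ⟨ht, ?_, ?_⟩
      · rcases hrt.eq_or_lt with rfl | hlt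
        · exact hr1
        · exact hθ.lt_of_le hpos n (Ioo_subset_Icc_self hr) (Ioo_subset_Icc_self ht) hlt hr1.le
      · rcases hts.eq_or_lt with rfl | hlt
        · exact hs2
        · by_contra! hcon
          have := hθ.lt_of_le hpos (n + 1) (Ioo_subset_Icc_self ht) (Ioo_subset_Icc_self hs) hlt
            (by push_cast; exact hcon)
          push_cast at this
          linarith
    convert isPreconnected_radial hN hIc fun r hr => ha.trans hr.1.1 using 1
    ext x
    simp only [mem_image, mem_preimage, mem_singleton_iff, mem_ofPred_eq, hI]
    constructor
    · rintro ⟨y, hy, rfl⟩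
      have := (hfib n y).1 hy
      rw [lt_div_iff₀ hpi, div_lt_iff₀ hpi] at this
      exact ⟨hIoo y, this⟩
    · rintro ⟨hx, hx1, hx2⟩
      have hxw : radialLift N w x ≠ 0 := by
        intro h0
        obtain ⟨j, hj⟩ := Real.sin_eq_zero_iff.1 ((hw _ hx).1 h0)
        rw [← hj] at hx1 hx2
        have h1 : n < j := by exact_mod_cast lt_of_mul_lt_mul_right hx1 hpi.le
        have h2 : j < n + 1 := by exact_mod_cast lt_of_mul_lt_mul_right hx2 hpi.le
        omega
      refine ⟨⟨x, hx, hxw⟩, (hfib n _).2 ?_, rfl⟩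
      rw [lt_div_iff₀ hpi, div_lt_iff₀ hpi]
      exact ⟨hx1, hx2⟩
  have hinj : Function.Injective hfc.connectedComponentsLift := by
    intro p q
    obtain ⟨x, rfl⟩ := ConnectedComponents.surjective_coe p
    obtain ⟨y, rfl⟩ := ConnectedComponents.surjective_coe q
    intro h
    rw [hfc.connectedComponentsLift_apply_coe, hfc.connectedComponentsLift_apply_coe] at h
    rw [ConnectedComponents.coe_eq_coe']
    exact (hpre (f y)).subset_connectedComponent rfl h
  have hrange : range hfc.connectedComponentsLift = Ico (0 : ℤ) k := by
    ext n
    constructor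
    · rintro ⟨p, rfl⟩
      obtain ⟨x, rfl⟩ := ConnectedComponents.surjective_coe p
      rw [hfc.connectedComponentsLift_apply_coe]
      have hx := hIoo x
      have h0 := hθ.pos hpos _ (Ioo_subset_Ioc_self hx)
      refine ⟨Int.floor_nonneg.2 (by positivity), ?_⟩
      rw [hf]
      show ⌊θ ‖x.1‖ / Real.pi⌋ < (k : ℤ)
      rw [Int.floor_lt, div_lt_iff₀ hpi]
      by_contra! hcon
      have := hθ.lt_of_le hpos k (Ioo_subset_Icc_self hx) (right_mem_Icc.2 hab.le) hx.2
        (by exact_mod_cast hcon)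
      rw [hk] at this
      exact absurd this (by simp)
    · rintro ⟨hn0, hnk⟩
      have hn0' : (0 : ℝ) ≤ n := by exact_mod_cast hn0
      have hnk' : (n : ℝ) + 1 ≤ k := by exact_mod_cast hnk
      -- The half-integer level lies strictly inside zone `n`, where the sine is nonzero.
      obtain ⟨r, hr, hrθ⟩ := intermediate_value_Icc hab.le hθ.continuousOn
        (show (n + 1 / 2) * Real.pi ∈ Icc (θ a) (θ b) by
          rw [hθ.left, hk]
          exact ⟨by positivity, by gcongr; linarith⟩)
      have hra : r ≠ a := by
        rintro rfl
        rw [hθ.left] at hrθ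
        have : 0 < (n + 1 / 2) * Real.pi := by positivity
        linarith
      have hrb : r ≠ b := by
        rintro rfl
        rw [hk] at hrθ
        have := mul_right_cancel₀ hpi.ne' hrθ
        linarith
      have hrI : r ∈ Ioo a b := ⟨lt_of_le_of_ne hr.1 hra.symm, lt_of_le_of_ne hr.2 hrb⟩
      obtain ⟨x, hx⟩ := exists_norm_eq_of_two_le hN (ha.le.trans hr.1)
      have hxw : radialLift N w x ≠ 0 := by
        intro h0
        rw [radialLift, hx] at h0
        obtain ⟨j, hj⟩ := Real.sin_eq_zero_iff.1 ((hw r hrI).1 h0)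
        rw [hrθ] at hj
        have h1 := mul_right_cancel₀ hpi.ne' hj
        have h2 : (2 * j : ℝ) = 2 * n + 1 := by linarith
        have h3 : 2 * j = 2 * n + 1 := by exact_mod_cast h2
        omega
      refine ⟨((⟨x, by show a < ‖x‖ ∧ ‖x‖ < b; rw [hx]; exact hrI, hxw⟩ : U) :
        ConnectedComponents U), ?_⟩
      rw [hfc.connectedComponentsLift_apply_coe, hfib, hx, hrθ, mul_div_cancel_right₀ _ hpi.ne']
      constructor <;> linarith
  rw [nodalZoneCount, ← Nat.card_range_of_injective hinj, hrange]
  simp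

/-! ### Calculus of radial functions -/

section Radial

/-- The real inner product as a continuous bilinear map. -/
noncomputable def realInnerSL (E : Type*) [NormedAddCommGroup E] [InnerProductSpace ℝ E] :
    E →L[ℝ] E →L[ℝ] ℝ :=
  LinearMap.mkContinuous₂ (innerₗ E) 1 fun x y => by
    simpa using abs_real_inner_le_norm x y

lemma realInnerSL_apply {E : Type*} [NormedAddCommGroup E] [InnerProductSpace ℝ E] (x : E) :
    realInnerSL E x = innerSL ℝ x := rfl

lemma norm_realInnerSL_le (E : Type*) [NormedAddCommGroup E] [InnerProductSpace ℝ E] :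
    ‖realInnerSL E‖ ≤ 1 :=
  LinearMap.mkContinuous₂_norm_le _ zero_le_one _

variable {N : ℕ} {a b : ℝ} {f f₁ f₂ : ℝ → ℝ}

lemma isOpen_annulus (N : ℕ) (a b : ℝ) : IsOpen (annulus N a b) :=
  (isOpen_lt continuous_const continuous_norm).inter (isOpen_lt continuous_norm continuous_const)

lemma hasFDerivAt_norm_of_ne_zero {E : Type*} [NormedAddCommGroup E] [InnerProductSpace ℝ E]
    {x : E} (hx : x ≠ 0) : HasFDerivAt (fun y : E => ‖y‖) (‖x‖⁻¹ • innerSL ℝ x) x := by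
  have hx' := norm_pos_iff.2 hx
  have h := (hasStrictFDerivAt_norm_sq x).hasFDerivAt.sqrt (by positivity)
  simp only [Real.sqrt_sq (norm_nonneg _)] at h
  convert h using 1
  rw [← Nat.cast_smul_eq_nsmul ℝ, smul_smul]
  congr 1
  field_simp
  norm_num

lemma hasFDerivAt_radialLift {x : EuclideanSpace ℝ (Fin N)} (hx : x ≠ 0)
    {d : ℝ} (hf : HasDerivAt f d ‖x‖) :
    HasFDerivAt (radialLift N f) ((d / ‖x‖) • innerSL ℝ x) x := by
  have h := hf.comp_hasFDerivAt x (hasFDerivAt_norm_of_ne_zero hx)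
  rwa [smul_smul, ← div_eq_mul_inv] at h

lemma ne_zero_of_mem_annulus (ha : 0 < a) {x : EuclideanSpace ℝ (Fin N)}
    (hx : x ∈ annulus N a b) : x ≠ 0 :=
  norm_pos_iff.1 (ha.trans hx.1)

/-- The gradient is `(f₁ r / r) x` with `r = |x|`; the Hessian follows by the product rule. -/
lemma hasFDerivAt_fderiv_radialLift (ha : 0 < a)
    (hf : ∀ r ∈ Ioo a b, HasDerivAt f (f₁ r) r) (hf₁ : ∀ r ∈ Ioo a b, HasDerivAt f₁ (f₂ r) r)
    {x : EuclideanSpace ℝ (Fin N)} (hx : x ∈ annulus N a b) :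
    HasFDerivAt (fderiv ℝ (radialLift N f))
      ((f₁ ‖x‖ / ‖x‖) • realInnerSL _ +
        ((((f₂ ‖x‖ - f₁ ‖x‖ / ‖x‖) / ‖x‖ ^ 2)) • innerSL ℝ x).smulRight (innerSL ℝ x)) x := by
  have hr : 0 < ‖x‖ := ha.trans hx.1
  have hd : HasDerivAt (fun r => f₁ r / r) ((f₂ ‖x‖ - f₁ ‖x‖ / ‖x‖) / ‖x‖) ‖x‖ := by
    refine ((hf₁ _ hx).div (hasDerivAt_id _) hr.ne').congr_deriv ?_
    simp only [id]; field_simp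
  have hq := hasFDerivAt_radialLift (ne_zero_of_mem_annulus ha hx) hd
  have h := hq.smul (realInnerSL (EuclideanSpace ℝ (Fin N))).hasFDerivAt
  rw [div_div, ← pow_two] at h
  refine h.congr_of_eventuallyEq ?_
  filter_upwards [(isOpen_annulus N a b).mem_nhds hx] with y hy
  exact (hasFDerivAt_radialLift (ne_zero_of_mem_annulus ha hy) (hf _ hy)).fderiv

lemma laplacian_radialLift (hN : 1 ≤ N) (ha : 0 < a)
    (hf : ∀ r ∈ Ioo a b, HasDerivAt f (f₁ r) r) (hf₁ : ∀ r ∈ Ioo a b, HasDerivAt f₁ (f₂ r) r)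
    {x : EuclideanSpace ℝ (Fin N)} (hx : x ∈ annulus N a b) :
    (Δ (radialLift N f)) x = f₂ ‖x‖ + (N - 1 : ℕ) / ‖x‖ * f₁ ‖x‖ := by
  have hr : 0 < ‖x‖ := ha.trans hx.1
  rw [InnerProductSpace.laplacian_eq_iteratedFDeriv_orthonormalBasis _
    (EuclideanSpace.basisFun (Fin N) ℝ)]
  simp only [iteratedFDeriv_two_apply]
  rw [(hasFDerivAt_fderiv_radialLift ha hf hf₁ hx).fderiv]
  have h1 : ∑ i, (x i) ^ 2 = ‖x‖ ^ 2 := by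
    rw [EuclideanSpace.norm_sq_eq]; simp
  have h2 : ∀ i, inner ℝ x (EuclideanSpace.single i (1 : ℝ)) = x i := by
    intro i; simp [EuclideanSpace.inner_single_right]
  have h3 : ∀ i : Fin N, inner ℝ (EuclideanSpace.single i (1 : ℝ))
      (EuclideanSpace.single i (1 : ℝ)) = (1 : ℝ) := by
    intro i; simp
  simp only [EuclideanSpace.basisFun_apply, Fin.isValue, Matrix.cons_val_zero,
    Matrix.cons_val_one, add_apply,
    smul_apply, ContinuousLinearMap.smulRight_apply, realInnerSL_apply, innerSL_apply_apply,
    smul_eq_mul, h2, h3]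
  rw [Finset.sum_add_distrib]
  have h4 : ∑ i, (f₂ ‖x‖ - f₁ ‖x‖ / ‖x‖) / ‖x‖ ^ 2 * x i * x i =
      f₂ ‖x‖ - f₁ ‖x‖ / ‖x‖ := by
    simp_rw [mul_assoc, ← pow_two]
    rw [← Finset.mul_sum, h1, div_mul_cancel₀ _ (by positivity)]
  rw [h4, Nat.cast_sub hN]
  simp
  ring

/-- Uniform convergence of the profile and its two derivatives is thereby enough for `C²`. The
Hessian contains `f₁ / r` twice and `r > a`, whence `2 / a`. -/
lemma norm_iteratedFDeriv_radialLift_le (ha : 0 < a)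
    (hf : ∀ r ∈ Ioo a b, HasDerivAt f (f₁ r) r) (hf₁ : ∀ r ∈ Ioo a b, HasDerivAt f₁ (f₂ r) r)
    {x : EuclideanSpace ℝ (Fin N)} (hx : x ∈ annulus N a b) {k : ℕ} (hk : k ≤ 2) :
    ‖iteratedFDeriv ℝ k (radialLift N f) x‖ ≤
      |f ‖x‖| + (1 + 2 / a) * |f₁ ‖x‖| + |f₂ ‖x‖| := by
  have hr : 0 < ‖x‖ := ha.trans hx.1
  have e0 := abs_nonneg (f ‖x‖)
  have e1 := abs_nonneg (f₁ ‖x‖)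
  have e2 := abs_nonneg (f₂ ‖x‖)
  have e3 : 0 ≤ 2 / a * |f₁ ‖x‖| := by positivity
  interval_cases k
  · rw [norm_iteratedFDeriv_zero]
    show |f ‖x‖| ≤ _
    linarith
  · rw [norm_iteratedFDeriv_one,
      (hasFDerivAt_radialLift (ne_zero_of_mem_annulus ha hx) (hf _ hx)).fderiv, norm_smul,
      innerSL_apply_norm, Real.norm_eq_abs, abs_div, abs_norm, div_mul_cancel₀ _ hr.ne']
    linarith
  · rw [← norm_iteratedFDeriv_fderiv, norm_iteratedFDeriv_one,
      (hasFDerivAt_fderiv_radialLift ha hf hf₁ hx).fderiv]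
    have h1 : |f₁ ‖x‖ / ‖x‖| ≤ |f₁ ‖x‖| / a := by
      rw [abs_div, abs_norm]
      exact div_le_div_of_nonneg_left e1 ha hx.1.le
    have h2 : ‖(f₁ ‖x‖ / ‖x‖) • realInnerSL (EuclideanSpace ℝ (Fin N))‖ ≤ |f₁ ‖x‖| / a := by
      refine (ContinuousLinearMap.opNorm_smul_le _ _).trans ?_
      rw [Real.norm_eq_abs]
      calc _ ≤ |f₁ ‖x‖ / ‖x‖| * 1 := by gcongr; exact norm_realInnerSL_le _
        _ ≤ _ := by rwa [mul_one]
    have h3 : ‖(((f₂ ‖x‖ - f₁ ‖x‖ / ‖x‖) / ‖x‖ ^ 2) • innerSL ℝ x).smulRight (innerSL ℝ x)‖ ≤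
        |f₂ ‖x‖| + |f₁ ‖x‖| / a := by
      rw [ContinuousLinearMap.norm_smulRight_apply, norm_smul, innerSL_apply_norm,
        Real.norm_eq_abs, abs_div, abs_of_pos (pow_pos hr 2), mul_assoc, ← pow_two,
        div_mul_cancel₀ _ (by positivity)]
      exact (abs_sub _ _).trans (by linarith)
    have h4 := norm_add_le ((f₁ ‖x‖ / ‖x‖) • realInnerSL (EuclideanSpace ℝ (Fin N)))
      ((((f₂ ‖x‖ - f₁ ‖x‖ / ‖x‖) / ‖x‖ ^ 2) • innerSL ℝ x).smulRight (innerSL ℝ x))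
    have h5 : 2 / a * |f₁ ‖x‖| = |f₁ ‖x‖| / a + |f₁ ‖x‖| / a := by ring
    linarith

lemma contDiffOn_radialLift (ha : 0 < a) {n : WithTop ℕ∞} (hf : ContDiffOn ℝ n f (Ioo a b)) :
    ContDiffOn ℝ n (radialLift N f) (annulus N a b) :=
  hf.comp (fun _ hx => (contDiffAt_norm ℝ (ne_zero_of_mem_annulus ha hx)).contDiffWithinAt)
    fun _ hx => hx

lemma closure_annulus_subset : closure (annulus N a b) ⊆ {x | a ≤ ‖x‖ ∧ ‖x‖ ≤ b} :=
  closure_minimal (fun _ hx => ⟨hx.1.le, hx.2.le⟩)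
    ((isClosed_le continuous_const continuous_norm).inter
      (isClosed_le continuous_norm continuous_const))

/-- A ray from the origin, parametrized by arc length. -/
lemma exists_ray (hN : 1 ≤ N) : ∃ e : ℝ → EuclideanSpace ℝ (Fin N),
    ContDiff ℝ 2 e ∧ ∀ r, 0 ≤ r → ‖e r‖ = r := by
  refine ⟨fun r => r • EuclideanSpace.single ⟨0, by omega⟩ 1,
    contDiff_id.smul contDiff_const, fun r hr => ?_⟩
  simp [norm_smul, abs_of_nonneg hr]

lemma mem_closure_annulus_of_ray (ha : 0 < a) (hab : a < b)
    {e : ℝ → EuclideanSpace ℝ (Fin N)} (he : Continuous e) (hn : ∀ r, 0 ≤ r → ‖e r‖ = r) {r : ℝ}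
    (hr : r ∈ Icc a b) : e r ∈ closure (annulus N a b) := by
  have h := image_closure_subset_closure_image he (s := Ioo a b)
  rw [closure_Ioo hab.ne] at h
  refine closure_mono ?_ (h ⟨r, hr, rfl⟩)
  rintro _ ⟨s, hs, rfl⟩
  show a < ‖e s‖ ∧ ‖e s‖ < b
  rw [hn s (ha.trans hs.1).le]
  exact hs

end Radial

/-! ### Radial Dirichlet solutions and Sturm–Liouville systems -/

lemma IsSturmSystem.hasDerivAt {a b : ℝ} {n : ℕ} {c w g : ℝ → ℝ} (ha : 0 < a)
    (h : IsSturmSystem a b (fun r => r ^ n) c w g) {r : ℝ} (hr : r ∈ Ioo a b) :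
    HasDerivAt w (g r / r ^ n) r ∧
      HasDerivAt (fun r => g r / r ^ n) (-(c r * w r) - n / r * (g r / r ^ n)) r := by
  have hr' := Ioo_subset_Icc_self hr
  have h0 : 0 < r := ha.trans hr.1
  refine ⟨(h.deriv_fst r hr').hasDerivAt (Icc_mem_nhds hr.1 hr.2), ?_⟩
  have h1 := ((h.deriv_snd r hr').hasDerivAt (Icc_mem_nhds hr.1 hr.2)).div
    (hasDerivAt_pow n r) (pow_pos h0 n).ne'
  refine h1.congr_deriv ?_
  rcases n with _ | n
  · simp
  · have : r ^ (n + 1 - 1) = r ^ n := rfl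
    rw [this]
    field_simp
    ring

/-- A radial solution of a semilinear Dirichlet problem in an annulus solves a Sturm–Liouville
system up to the boundary. -/
theorem IsClassicalDirichletSolution.exists_isSturmSystem {N : ℕ} (hN : 1 ≤ N) {a b : ℝ}
    (ha : 0 < a) (hab : a < b) {γ v : ℝ → ℝ} (hγ : Continuous γ)
    (h : IsClassicalDirichletSolution (annulus N a b) (fun t => γ t * t) (radialLift N v)) :
    v a = 0 ∧ v b = 0 ∧
      ∃ g, IsSturmSystem a b (fun r => r ^ (N - 1)) (fun r => γ (v r)) v g := by
  obtain ⟨e, hec, hen⟩ := exists_ray hN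
  have hmem : ∀ r ∈ Ioo a b, e r ∈ annulus N a b := by
    intro r hr
    show a < ‖e r‖ ∧ ‖e r‖ < b
    rw [hen r (ha.trans hr.1).le]; exact hr
  have hev : ∀ r ∈ Icc a b, radialLift N v (e r) = v r := by
    intro r hr
    rw [radialLift, hen r (ha.le.trans hr.1)]
  have hcont : ContinuousOn v (Icc a b) :=
    (h.continuousOn.comp hec.continuous.continuousOn fun r hr =>
      mem_closure_annulus_of_ray ha hab hec.continuous hen hr).congr fun r hr => (hev r hr).symm
  have hbd : ∀ r ∈ Icc a b, r ∉ Ioo a b → v r = 0 := by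
    intro r hr hr'
    rw [← hev r hr]
    refine h.boundary _ ⟨mem_closure_annulus_of_ray ha hab hec.continuous hen hr, ?_⟩
    rw [(isOpen_annulus N a b).interior_eq]
    intro hcon
    have : a < ‖e r‖ ∧ ‖e r‖ < b := hcon
    rw [hen r (ha.le.trans hr.1)] at this
    exact hr' this
  refine ⟨hbd a (left_mem_Icc.2 hab.le) (by simp), hbd b (right_mem_Icc.2 hab.le) (by simp), ?_⟩
  have hC2 : ContDiffOn ℝ 2 v (Ioo a b) :=
    (h.contDiffOn.comp hec.contDiffOn hmem).congr
      fun r hr => (hev r (Ioo_subset_Icc_self hr)).symm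
  have hC2' : ContDiffOn ℝ (1 + 1) v (Ioo a b) := by
    rw [one_add_one_eq_two]; exact hC2
  obtain ⟨hd1, -, hC1⟩ := (contDiffOn_succ_iff_deriv_of_isOpen isOpen_Ioo).1 hC2'
  have hv1 : ∀ r ∈ Ioo a b, HasDerivAt v (deriv v r) r := fun r hr =>
    (hd1.differentiableAt (isOpen_Ioo.mem_nhds hr)).hasDerivAt
  have hv2 : ∀ r ∈ Ioo a b, HasDerivAt (deriv v) (deriv (deriv v) r) r := fun r hr =>
    ((hC1.differentiableOn one_ne_zero).differentiableAt (isOpen_Ioo.mem_nhds hr)).hasDerivAt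
  have heq : ∀ r ∈ Ioo a b,
      deriv (deriv v) r + (N - 1 : ℕ) / r * deriv v r = -(γ (v r) * v r) := by
    intro r hr
    have h1 := h.equation _ (hmem r hr)
    rw [laplacian_radialLift hN ha hv1 hv2 (hmem r hr), hen r (ha.trans hr.1).le,
      hev r (Ioo_subset_Icc_self hr)] at h1
    linarith
  have hF : ContinuousOn (fun r => -(r ^ (N - 1) * γ (v r) * v r)) (Icc a b) :=
    (((continuous_pow _).continuousOn.mul (hγ.comp_continuousOn hcont)).mul hcont).neg
  -- The equation is known only in the open interval. The flux `r ^ (N - 1) v'` differs there by a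
  -- constant from `K`, which is differentiable up to the endpoints; the same device is then applied
  -- to `v`.
  obtain ⟨K, -, hK⟩ := exists_hasDerivWithinAt_Icc hab.le hF
  have hK' : ∀ r ∈ Ioo a b, HasDerivAt K (-(r ^ (N - 1) * γ (v r) * v r)) r := fun r hr =>
    (hK r (Ioo_subset_Icc_self hr)).hasDerivAt (Icc_mem_nhds hr.1 hr.2)
  have hPv : ∀ r ∈ Ioo a b, HasDerivAt (fun r => r ^ (N - 1) * deriv v r)
      (-(r ^ (N - 1) * γ (v r) * v r)) r := by
    intro r hr
    have h0 : 0 < r := ha.trans hr.1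
    refine ((hasDerivAt_pow (N - 1) r).mul (hv2 r hr)).congr_deriv ?_
    have h1 : deriv (deriv v) r = -(γ (v r) * v r) - (N - 1 : ℕ) / r * deriv v r := by
      linarith [heq r hr]
    rw [h1]
    rcases N - 1 with _ | n
    · simp
    · have : r ^ (n + 1 - 1) = r ^ n := rfl
      rw [this]
      field_simp
      ring
  obtain ⟨C, hC⟩ := isOpen_Ioo.exists_eq_add_of_deriv_eq isPreconnected_Ioo
    (fun r hr => (hPv r hr).differentiableAt.differentiableWithinAt)
    (fun r hr => (hK' r hr).differentiableAt.differentiableWithinAt)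
    (fun r hr => by rw [(hPv r hr).deriv, (hK' r hr).deriv])
  have hKd : ∀ r ∈ Icc a b, HasDerivWithinAt (fun r => K r + C)
      (-(r ^ (N - 1) * γ (v r) * v r)) (Icc a b) r := fun r hr => (hK r hr).add_const C
  refine ⟨fun r => K r + C, ?_, hKd⟩
  obtain ⟨W, -, hW⟩ := exists_hasDerivWithinAt_Icc (k := fun r => (K r + C) / r ^ (N - 1)) hab.le
    (ContinuousOn.div (fun r hr => (hKd r hr).continuousWithinAt) (continuous_pow _).continuousOn
      fun r hr => (pow_pos (ha.trans_le hr.1) _).ne')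
  have hW' : ∀ r ∈ Ioo a b, HasDerivAt W ((K r + C) / r ^ (N - 1)) r := fun r hr =>
    (hW r (Ioo_subset_Icc_self hr)).hasDerivAt (Icc_mem_nhds hr.1 hr.2)
  obtain ⟨C', hC'⟩ := isOpen_Ioo.exists_eq_add_of_deriv_eq isPreconnected_Ioo hd1
    (fun r hr => (hW' r hr).differentiableAt.differentiableWithinAt)
    (fun r hr => by
      rw [(hW' r hr).deriv, eq_div_iff (pow_pos (ha.trans hr.1) _).ne', mul_comm]
      exact hC hr)
  have hvW : EqOn v (fun r => W r + C') (Icc a b) :=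
    hC'.of_subset_closure hcont
      (fun r hr => ((hW r hr).add_const C').continuousWithinAt) Ioo_subset_Icc_self
      (by rw [closure_Ioo hab.ne])
  intro r hr
  exact ((hW r hr).add_const C').congr hvW (hvW hr)

/-- Solutions of Sturm–Liouville systems with zero boundary values are profiles of radial
Dirichlet solutions. -/
theorem IsSturmSystem.isClassicalDirichletSolution {N : ℕ} (hN : 1 ≤ N) {a b μ : ℝ} (ha : 0 < a)
    {w g : ℝ → ℝ} (h : IsSturmSystem a b (fun r => r ^ (N - 1)) (fun _ => μ) w g)
    (hwa : w a = 0) (hwb : w b = 0) :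
    IsClassicalDirichletSolution (annulus N a b) (fun t => μ * t) (radialLift N w) where
  contDiffOn := by
    refine contDiffOn_radialLift ha ?_
    rw [← one_add_one_eq_two, contDiffOn_succ_iff_deriv_of_isOpen isOpen_Ioo]
    refine ⟨fun r hr => (h.hasDerivAt ha hr).1.differentiableAt.differentiableWithinAt,
      by simp, ?_⟩
    refine ContDiffOn.congr (f := fun r => g r / r ^ (N - 1)) ?_
      fun r hr => (h.hasDerivAt ha hr).1.deriv
    rw [← zero_add 1, contDiffOn_succ_iff_deriv_of_isOpen isOpen_Ioo]
    refine ⟨fun r hr => (h.hasDerivAt ha hr).2.differentiableAt.differentiableWithinAt,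
      by simp, ?_⟩
    rw [contDiffOn_zero]
    refine ContinuousOn.congr ?_ fun r hr => (h.hasDerivAt ha hr).2.deriv
    have hne : ∀ r ∈ Ioo a b, r ≠ 0 := fun r hr => (ha.trans hr.1).ne'
    exact ((continuousOn_const.mul (h.continuousOn_fst.mono Ioo_subset_Icc_self)).neg).sub
      ((continuousOn_const.div continuousOn_id hne).mul
        ((h.continuousOn_snd.mono Ioo_subset_Icc_self).div (continuous_pow _).continuousOn
          fun r hr => pow_ne_zero _ (hne r hr)))
  continuousOn :=
    h.continuousOn_fst.comp continuous_norm.continuousOn fun _ hx => closure_annulus_subset hx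
  equation x hx := by
    rw [laplacian_radialLift hN ha (fun r hr => (h.hasDerivAt ha hr).1)
      (fun r hr => (h.hasDerivAt ha hr).2) hx, radialLift]
    ring
  boundary x hx := by
    rw [frontier, (isOpen_annulus N a b).interior_eq] at hx
    have h1 : a ≤ ‖x‖ ∧ ‖x‖ ≤ b := closure_annulus_subset hx.1
    rcases h1.1.eq_or_lt with e | h2
    · rw [radialLift, ← e, hwa]
    · rcases h1.2.eq_or_lt with e | h3
      · rw [radialLift, e, hwb]
      · exact absurd ⟨h2, h3⟩ hx.2

/-! ### Radial eigenvalues in terms of the Prüfer angle -/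

section Eigenvalues

variable {N : ℕ} {a b : ℝ}

lemma pow_pos_of_mem_Icc (n : ℕ) (ha : 0 < a) : ∀ r ∈ Icc a b, 0 < r ^ n :=
  fun _ hr => pow_pos (ha.trans_le hr.1) n

lemma IsPruferAngle.exists_nat_of_sin_eq_zero {P c θ : ℝ → ℝ} (hab : a < b)
    (hpos : ∀ t ∈ Icc a b, 0 < P t) (h : IsPruferAngle a b P c θ) (hs : Real.sin (θ b) = 0) :
    ∃ k : ℕ, 1 ≤ k ∧ θ b = k * Real.pi := by
  obtain ⟨j, hj⟩ := Real.sin_eq_zero_iff.1 hs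
  have h0 := h.pos hpos b ⟨hab, le_rfl⟩
  have hj0 : 0 < j := by
    rw [← hj] at h0
    exact_mod_cast pos_of_mul_pos_left h0 Real.pi_pos.le
  lift j to ℕ using hj0.le
  exact ⟨j, by exact_mod_cast hj0, by exact_mod_cast hj.symm⟩

/-- A nontrivial profile has `g a ≠ 0` by uniqueness; after a change of sign if necessary, the
Prüfer representation applies, and the zero at `b` makes the sine of the angle vanish. -/
lemma IsRadialEigenfunction.exists_nat (hN : 1 ≤ N) (ha : 0 < a) (hab : a < b) {μ : ℝ}
    {ψ θ : ℝ → ℝ} (hψ : IsRadialEigenfunction N a b μ ψ)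
    (hθ : IsPruferAngle a b (fun r => r ^ (N - 1)) (fun _ => μ) θ) :
    ∃ k : ℕ, 1 ≤ k ∧ θ b = k * Real.pi := by
  have hP : ContinuousOn (fun r : ℝ => r ^ (N - 1)) (Icc a b) := (continuous_pow _).continuousOn
  have hpos := pow_pos_of_mem_Icc (b := b) (N - 1) ha
  have hb := right_mem_Icc.2 hab.le
  obtain ⟨h0, h1, g, hg⟩ := hψ.solves.exists_isSturmSystem (γ := fun _ => μ) hN ha hab
    continuous_const
  have key : ∀ k : ℝ, 0 < k * g a → Real.sin (θ b) = 0 := by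
    intro k hk
    obtain ⟨S, hS, hSw⟩ := (hg.const_mul k).exists_eq_mul_sin hab.le hP hpos continuousOn_const hθ
      (by simp [h0]) hk
    have h2 := (hSw b hb).1
    rw [h1, mul_zero] at h2
    exact (mul_eq_zero.1 h2.symm).resolve_left (hS b).ne'
  refine hθ.exists_nat_of_sin_eq_zero hab hpos ?_
  rcases lt_trichotomy (g a) 0 with h | h | h
  · exact key (-1) (by linarith)
  · exfalso
    obtain ⟨x, hx, hx'⟩ := hψ.nontrivial
    refine hx' ?_
    have h2 := hg.eqOn hab.le hP hpos continuousOn_const (hg.const_mul 0) (by simp [h0])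
      (by simp [h]) ‖x‖ ⟨hx.1.le, hx.2.le⟩
    have h3 : ψ ‖x‖ = 0 := by simpa using h2.1
    exact h3
  · exact key 1 (by linarith)

lemma mem_radialEigenvalues_of_angle (hN : 2 ≤ N) (ha : 0 < a) (hab : a < b) {μ : ℝ}
    {θ : ℝ → ℝ} (hθ : IsPruferAngle a b (fun r => r ^ (N - 1)) (fun _ => μ) θ) {k : ℕ}
    (hk : θ b = k * Real.pi) : μ ∈ radialEigenvalues N a b := by
  have hpos := pow_pos_of_mem_Icc (b := b) (N - 1) ha
  obtain ⟨S, hS, -, hsys⟩ := IsSturmSystem.exists_of_isPruferAngle hab.le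
    (continuous_pow (N - 1)).continuousOn hpos continuousOn_const hθ
  refine ⟨_, hsys.isClassicalDirichletSolution (by omega) ha (by simp [hθ.left])
    (by simp [hk]), ?_⟩
  obtain ⟨r, hr, h0, hpi⟩ := hθ.exists_mem_Ioo hab hpos
  obtain ⟨x, hx⟩ := exists_norm_eq_of_two_le hN (ha.trans hr.1).le
  refine ⟨x, ?_, ?_⟩
  · show a < ‖x‖ ∧ ‖x‖ < b
    rw [hx]; exact hr
  · rw [radialLift, hx]
    exact mul_ne_zero (hS r).ne' (Real.sin_pos_of_pos_of_lt_pi h0 hpi).ne'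

/-- The `m`-th radial eigenvalue is the one whose Prüfer angle ends at `m π`. -/
theorem IsRadialEigenvalueNumber.angle_eq (hN : 2 ≤ N) (ha : 0 < a) (hab : a < b) {m : ℕ}
    {lam : ℝ} (h : IsRadialEigenvalueNumber N a b m lam) {Θ : ℝ → ℝ → ℝ}
    (hΘ : ∀ μ, IsPruferAngle a b (fun r => r ^ (N - 1)) (fun _ => μ) (Θ μ)) :
    0 < lam ∧ Θ lam b = m * Real.pi := by
  have hpi := Real.pi_pos
  have hP : ContinuousOn (fun r : ℝ => r ^ (N - 1)) (Icc a b) := (continuous_pow _).continuousOn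
  have hpos := pow_pos_of_mem_Icc (b := b) (N - 1) ha
  have hmono : StrictMono fun μ => Θ μ b := fun μ ν hμν =>
    (hΘ μ).right_lt_right hab hP hpos (hΘ ν) hμν
  have hcont := IsPruferAngle.continuous_right hab.le hP hpos hΘ
  have h0 := (hΘ 0).right_lt_pi_of_zero hab.le hP hpos
  obtain ⟨ψ, hψ⟩ := h.1
  obtain ⟨k, hk, hkΘ⟩ := hψ.exists_nat (by omega) ha hab (hΘ lam)
  have hk' : (1 : ℝ) ≤ k := by exact_mod_cast hk
  have hlam : 0 < lam := hmono.lt_iff_lt.1 (by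
    show Θ 0 b < Θ lam b
    rw [hkΘ]; nlinarith)
  refine ⟨hlam, ?_⟩
  -- The final angle is injective in `μ`, so the eigenvalues up to `lam` can be counted through
  -- their images `π, …, k π`; this gives `k = m`.
  have himage : (fun μ => Θ μ b) '' {κ ∈ radialEigenvalues N a b | κ ≤ lam} =
      (fun j : ℕ => j * Real.pi) '' (Finset.Icc 1 k : Set ℕ) := by
    ext t
    constructor
    · rintro ⟨κ, ⟨⟨φ, hφ⟩, hκ⟩, rfl⟩
      obtain ⟨j, hj, hjΘ⟩ := hφ.exists_nat (by omega) ha hab (hΘ κ)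
      refine ⟨j, ?_, hjΘ.symm⟩
      have h1 : Θ κ b ≤ Θ lam b := hmono.monotone hκ
      rw [hjΘ, hkΘ] at h1
      have h2 : j ≤ k := by exact_mod_cast le_of_mul_le_mul_right h1 hpi
      simp [hj, h2]
    · rintro ⟨j, hj, rfl⟩
      have hj' : 1 ≤ j ∧ j ≤ k := by simpa using hj
      have hj1 : (1 : ℝ) ≤ j := by exact_mod_cast hj'.1
      have hj2 : (j : ℝ) ≤ k := by exact_mod_cast hj'.2
      obtain ⟨κ, hκ, hκΘ⟩ := intermediate_value_Icc hlam.le hcont.continuousOn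
        (show (j : ℝ) * Real.pi ∈ Icc (Θ 0 b) (Θ lam b) by
          rw [hkΘ]; exact ⟨by nlinarith, by gcongr⟩)
      exact ⟨κ, ⟨mem_radialEigenvalues_of_angle hN ha hab (hΘ κ) hκΘ, hκ.2⟩, hκΘ⟩
  have hinj : Function.Injective fun j : ℕ => (j : ℝ) * Real.pi := fun i j hij => by
    exact_mod_cast mul_right_cancel₀ hpi.ne' hij
  have hcard := h.2
  rw [← hmono.injective.encard_image, himage, hinj.encard_image,
    Set.encard_coe_eq_coe_finsetCard] at hcard
  simp only [Nat.card_Icc, add_tsub_cancel_right] at hcard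
  have : k = m := by exact_mod_cast hcard
  rw [hkΘ, this]

end Eigenvalues

/-! ### Normalized nodal solutions -/

section Nodal

variable {N : ℕ} {a b : ℝ}

lemma supNormOn_radialLift (hN : 2 ≤ N) (ha : 0 < a) (hab : a < b) {f : ℝ → ℝ}
    (hf : ContinuousOn f (Icc a b)) (hfa : f a = 0) (hfb : f b = 0) :
    (∀ r ∈ Icc a b, |f r| ≤ supNormOn (annulus N a b) (radialLift N f)) ∧
      ∃ r ∈ Icc a b, |f r| = supNormOn (annulus N a b) (radialLift N f) := by
  obtain ⟨s, hs, hmax⟩ := isCompact_Icc.exists_isMaxOn (nonempty_Icc.2 hab.le) hf.abs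
  have hle : ∀ y ∈ (fun x => |radialLift N f x|) '' annulus N a b, y ≤ |f s| := by
    rintro _ ⟨x, hx, rfl⟩
    exact hmax (show ‖x‖ ∈ Icc a b from ⟨hx.1.le, hx.2.le⟩)
  have hge : ∀ r ∈ Ioo a b, |f r| ≤ supNormOn (annulus N a b) (radialLift N f) := by
    intro r hr
    obtain ⟨x, hx⟩ := exists_norm_eq_of_two_le hN (ha.trans hr.1).le
    refine le_csSup ⟨_, hle⟩ ⟨x, ?_, ?_⟩
    · show a < ‖x‖ ∧ ‖x‖ < b
      rw [hx]; exact hr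
    · show |f ‖x‖| = |f r|
      rw [hx]
  have hmid : (a + b) / 2 ∈ Ioo a b := ⟨by linarith, by linarith⟩
  have h0 : 0 ≤ supNormOn (annulus N a b) (radialLift N f) :=
    (abs_nonneg _).trans (hge _ hmid)
  have hall : ∀ r ∈ Icc a b, |f r| ≤ supNormOn (annulus N a b) (radialLift N f) := by
    intro r hr
    rcases hr.1.eq_or_lt with rfl | h1
    · simpa [hfa] using h0
    rcases hr.2.eq_or_lt with rfl | h2
    · simpa [hfb] using h0
    · exact hge r ⟨h1, h2⟩
  refine ⟨hall, s, hs, le_antisymm (hall s hs) (csSup_le ?_ hle)⟩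
  obtain ⟨x, hx⟩ := exists_norm_eq_of_two_le hN (ha.trans hmid.1).le
  refine ⟨_, ⟨x, ?_, rfl⟩⟩
  show a < ‖x‖ ∧ ‖x‖ < b
  rw [hx]; exact hmid

lemma IsSturmSystem.left_pos {P c w g : ℝ → ℝ} (hab : a < b) (h : IsSturmSystem a b P c w g)
    (hpos : 0 < P a) (hd : 0 < derivWithin w (Icc a b) a) : 0 < g a := by
  have ha := left_mem_Icc.2 hab.le
  rw [(h.deriv_fst a ha).derivWithin (uniqueDiffOn_Icc hab a ha)] at hd
  simpa [div_mul_cancel₀ _ hpos.ne'] using mul_pos hd hpos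

/-- `w`, with `h = r ^ (N - 1) w'`, is a nodal solution of
`-Δ w = lam |w| ^ (p - 1) w` of sup norm `1`, with Prüfer angle `θ`. -/
structure IsNormalizedNodal (N : ℕ) (a b : ℝ) (m : ℕ) (p lam : ℝ) (w h θ : ℝ → ℝ) : Prop where
  system : IsSturmSystem a b (fun r => r ^ (N - 1)) (fun r => lam * |w r| ^ (p - 1)) w h
  angle : IsPruferAngle a b (fun r => r ^ (N - 1)) (fun r => lam * |w r| ^ (p - 1)) θ
  left : w a = 0
  left_pos : 0 < h a
  angle_right : θ b = m * Real.pi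
  abs_le : ∀ r ∈ Icc a b, |w r| ≤ 1
  exists_abs_eq : ∃ r ∈ Icc a b, |w r| = 1

lemma continuous_abs_rpow {q : ℝ} (hq : 0 < q) : Continuous fun t : ℝ => |t| ^ q :=
  continuous_abs.rpow_const fun _ => Or.inr hq.le

/-- The factor `M ^ (p - 1)` exactly compensates the rescaling inside the power, so `v` and `v / M`
have the same potential and the same angle. -/
theorem IsRadialNodalSolution.exists_isNormalizedNodal (hN : 2 ≤ N) (ha : 0 < a) (hab : a < b)
    {m : ℕ} {p : ℝ} (hp : 1 < p) {v : ℝ → ℝ} (hv : IsRadialNodalSolution N a b m p v) :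
    0 < supNormOn (annulus N a b) (radialLift N v) ∧ ∃ h θ,
      IsNormalizedNodal N a b m p (supNormOn (annulus N a b) (radialLift N v) ^ (p - 1))
        (fun r => (supNormOn (annulus N a b) (radialLift N v))⁻¹ * v r) h θ := by
  have hP : ContinuousOn (fun r : ℝ => r ^ (N - 1)) (Icc a b) := (continuous_pow _).continuousOn
  have hpos := pow_pos_of_mem_Icc (b := b) (N - 1) ha
  have hγ := continuous_abs_rpow (show 0 < p - 1 by linarith)
  obtain ⟨h0, h1, g, hg⟩ := hv.solves.exists_isSturmSystem (γ := fun t => |t| ^ (p - 1))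
    (by omega) ha hab hγ
  have hga := hg.left_pos hab (hpos a (left_mem_Icc.2 hab.le)) hv.deriv_pos
  have hc : ContinuousOn (fun r => |v r| ^ (p - 1)) (Icc a b) :=
    hγ.comp_continuousOn hg.continuousOn_fst
  obtain ⟨θ, hθ⟩ := exists_isPruferAngle hab.le hP hpos hc
  obtain ⟨S, hS, hSw⟩ := hg.exists_eq_mul_sin hab.le hP hpos hc hθ h0 hga
  have hsin : Real.sin (θ b) = 0 := by
    have h2 := (hSw b (right_mem_Icc.2 hab.le)).1
    rw [h1] at h2
    exact (mul_eq_zero.1 h2.symm).resolve_left (hS b).ne'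
  obtain ⟨k, -, hk⟩ := hθ.exists_nat_of_sin_eq_zero hab hpos hsin
  have hzones := nodalZoneCount_radialLift hN ha hab hpos hθ hk (w := v) fun t ht => by
    rw [(hSw t (Ioo_subset_Icc_self ht)).1, mul_eq_zero, or_iff_right (hS t).ne']
  rw [hv.nodalZones] at hzones
  obtain ⟨hle, r, hr, hrM⟩ := supNormOn_radialLift hN ha hab hg.continuousOn_fst h0 h1
  set M := supNormOn (annulus N a b) (radialLift N v) with hMdef
  have hM : 0 < M := by
    obtain ⟨t, ht, ht0, htpi⟩ := hθ.exists_mem_Ioo hab hpos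
    have ht' := Ioo_subset_Icc_self ht
    refine lt_of_lt_of_le (abs_pos.2 ?_) (hle t ht')
    rw [(hSw t ht').1]
    exact mul_ne_zero (hS t).ne' (Real.sin_pos_of_pos_of_lt_pi ht0 htpi).ne'
  have hpot : (fun r => M ^ (p - 1) * |M⁻¹ * v r| ^ (p - 1)) = fun r => |v r| ^ (p - 1) := by
    ext r
    rw [← Real.mul_rpow hM.le (abs_nonneg _), abs_mul, abs_inv, abs_of_pos hM,
      mul_inv_cancel_left₀ hM.ne']
  have habs : ∀ r, |M⁻¹ * v r| = |v r| / M := fun r => by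
    rw [abs_mul, abs_inv, abs_of_pos hM, inv_mul_eq_div]
  refine ⟨hM, fun r => M⁻¹ * g r, θ, ?_⟩
  constructor
  · rw [hpot]; exact hg.const_mul _
  · rw [hpot]; exact hθ
  · simp [h0]
  · have := inv_pos.2 hM
    positivity
  · rw [hk, hzones]
  · intro r hr
    rw [habs, div_le_one hM]; exact hle r hr
  · exact ⟨r, hr, by rw [habs, hrM, div_self hM.ne']⟩

end Nodal

/-! ### A priori estimates -/

/-- From `x ^ q ≥ 1 + q log x ≥ 1 + q (1 - 1 / x)`. The factor `x` makes the bound uniform down to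
`x = 0`, where `x ^ q → 1` fails. -/
lemma mul_one_sub_rpow_le {x q : ℝ} (hx0 : 0 ≤ x) (hx1 : x ≤ 1) (hq : 0 < q) :
    0 ≤ x * (1 - x ^ q) ∧ x * (1 - x ^ q) ≤ q := by
  have h1 : x ^ q ≤ 1 := Real.rpow_le_one hx0 hx1 hq.le
  refine ⟨mul_nonneg hx0 (by linarith), ?_⟩
  rcases hx0.eq_or_lt with rfl | hx
  · simpa using hq.le
  have h2 : 1 + q * (1 - x⁻¹) ≤ x ^ q := by
    rw [Real.rpow_def_of_pos hx]
    have h3 := Real.one_sub_inv_le_log_of_pos hx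
    have h4 := Real.add_one_le_exp (Real.log x * q)
    nlinarith
  have h5 : x * (1 - x ^ q) ≤ x * (q * (x⁻¹ - 1)) := by
    refine mul_le_mul_of_nonneg_left ?_ hx0
    linarith
  have h6 : x * (q * (x⁻¹ - 1)) = q * (1 - x) := by field_simp
  nlinarith

/-- The energy of a solution of `(r ^ n w')' = - r ^ n lam |w| ^ q w` does not decrease, and
after division by `r ^ (2 n)` does not increase. -/
theorem IsSturmSystem.le_energy {a b q lam : ℝ} {n : ℕ} {w h : ℝ → ℝ} (ha : 0 < a) (hq : 0 < q)
    (hlam : 0 ≤ lam)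
    (hs : IsSturmSystem a b (fun r => r ^ n) (fun r => lam * |w r| ^ q) w h)
    (hle : ∀ r ∈ Icc a b, |w r| ≤ 1) (hex : ∃ r ∈ Icc a b, |w r| = 1) :
    ∀ r ∈ Icc a b,
      (a ^ n) ^ 2 * (lam / (q + 2)) ≤ h r ^ 2 / 2 + (b ^ n) ^ 2 * (lam / (q + 2)) * w r ^ 2 := by
  -- With `w' = h / r ^ n` this is kinetic plus potential energy, and `F' = -(n / r) w' ^ 2`.
  set F : ℝ → ℝ := fun r => (h r / r ^ n) ^ 2 / 2 + lam / (q + 2) * |w r| ^ (q + 2) with hF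
  have hint : interior (Icc a b) = Ioo a b := interior_Icc
  have hpow : ∀ r ∈ Icc a b, r ^ n ≠ 0 := fun r hr => (pow_pos (ha.trans_le hr.1) n).ne'
  have hFc : ContinuousOn F (Icc a b) :=
    (((hs.continuousOn_snd.div (continuous_pow n).continuousOn hpow).pow 2).div_const 2).add
      (continuousOn_const.mul
        ((continuous_abs_rpow (by linarith)).comp_continuousOn hs.continuousOn_fst))
  have hFd : ∀ r ∈ Ioo a b, HasDerivAt F (-(n / r) * (h r / r ^ n) ^ 2) r := by
    intro r hr
    obtain ⟨h1, h2⟩ := hs.hasDerivAt ha hr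
    have h3 := (hasDerivAt_abs_rpow (w r) (show 1 < q + 2 by linarith)).comp r h1
    refine (((h2.pow 2).div_const 2).add (h3.const_mul (lam / (q + 2)))).congr_deriv ?_
    rw [show q + 2 - 2 = q by ring]
    push_cast
    field_simp
    ring
  have hanti : AntitoneOn F (Icc a b) := by
    refine antitoneOn_of_hasDerivWithinAt_nonpos (convex_Icc a b) hFc
      (fun r hr => (hFd r (hint ▸ hr)).hasDerivWithinAt) fun r hr => ?_
    rw [hint] at hr
    have : 0 < r := ha.trans hr.1
    have h1 : 0 ≤ (n / r) * (h r / r ^ n) ^ 2 := by positivity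
    linarith
  have hmono : MonotoneOn (fun r => (r ^ n) ^ 2 * F r) (Icc a b) := by
    refine monotoneOn_of_hasDerivWithinAt_nonneg (convex_Icc a b)
      (((continuous_pow n).continuousOn.pow 2).mul hFc)
      (fun r hr => (((hasDerivAt_pow n r).pow 2).mul (hFd r (hint ▸ hr))).hasDerivWithinAt)
      fun r hr => ?_
    rw [hint] at hr
    have hr0 : 0 < r := ha.trans hr.1
    have e : (n : ℝ) * r ^ (n - 1) = n / r * r ^ n := by
      rcases n with _ | n
      · simp
      · have : r ^ (n + 1 - 1) = r ^ n := rfl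
        rw [this]; field_simp; ring
    have h1 : 0 ≤ 2 * (n / r) * (r ^ n) ^ 2 * (lam / (q + 2) * |w r| ^ (q + 2)) := by positivity
    refine h1.trans (le_of_eq ?_)
    simp only [Nat.cast_ofNat, Nat.add_one_sub_one, pow_one, e, hF, Pi.pow_apply]
    ring
  obtain ⟨s, hsI, hs1⟩ := hex
  have hFs : lam / (q + 2) ≤ F s := by
    simp only [hF, hs1, Real.one_rpow, mul_one]
    have := sq_nonneg (h s / s ^ n)
    linarith
  have h0 : 0 ≤ lam / (q + 2) := by positivity
  have hpa : ∀ r ∈ Icc a b, (a ^ n) ^ 2 ≤ (r ^ n) ^ 2 := fun r hr => by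
    have := hr.1
    gcongr
  intro r hr
  -- At the extremum `s` the energy is at least `lam / (q + 2)`. This bound travels left because `F`
  -- decreases and right because `r ^ (2 n) F` increases.
  have hE : (a ^ n) ^ 2 * (lam / (q + 2)) ≤ (r ^ n) ^ 2 * F r := by
    rcases le_total r s with hrs | hrs
    · have h1 := hanti hr hsI hrs
      exact mul_le_mul (hpa r hr) (hFs.trans h1) h0 (by positivity)
    · have h1 := hmono hsI hr hrs
      exact (mul_le_mul (hpa s hsI) hFs h0 (by positivity)).trans h1
  refine hE.trans ?_
  have hw : |w r| ^ (q + 2) ≤ w r ^ 2 := by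
    rw [← sq_abs (w r), ← Real.rpow_two]
    exact Real.rpow_le_rpow_of_exponent_ge_of_imp (abs_nonneg _) (hle r hr) (by linarith)
      (fun _ h => absurd h (by linarith))
  have hr0 : 0 < r := ha.trans_le hr.1
  have e : (r ^ n) ^ 2 * F r = h r ^ 2 / 2 + (r ^ n) ^ 2 * (lam / (q + 2) * |w r| ^ (q + 2)) := by
    simp only [hF]
    field_simp
  rw [e, mul_assoc]
  have hrb : (r ^ n) ^ 2 ≤ (b ^ n) ^ 2 := by
    have := hr.2
    gcongr
  have := mul_le_mul hrb (mul_le_mul_of_nonneg_left hw h0) (by positivity)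
    (by positivity)
  linarith

/-- A lower bound, uniform in `q` and `lam`, of the modulus of the vector `(w, h)`. -/
theorem exists_le_sq_add_sq {a b lam₀ : ℝ} (n : ℕ) (ha : 0 < a) (hlam₀ : 0 < lam₀) :
    ∃ κ, 0 < κ ∧ κ ≤ 1 ∧ ∀ (q lam : ℝ) (w h : ℝ → ℝ), 0 < q → q ≤ 1 → lam₀ ≤ lam →
      IsSturmSystem a b (fun r => r ^ n) (fun r => lam * |w r| ^ q) w h →
      (∀ r ∈ Icc a b, |w r| ≤ 1) → (∃ r ∈ Icc a b, |w r| = 1) →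
      ∀ r ∈ Icc a b, κ ^ 2 ≤ w r ^ 2 + h r ^ 2 := by
  -- The first two terms dominate the coefficients of `h ^ 2` (using `q ≤ 1`) and `w ^ 2`; the last
  -- ensures `κ ≤ 1`.
  set D := 3 / (2 * lam₀) + (b ^ n) ^ 2 + (a ^ n) ^ 2 with hD
  have hDpos : 0 < D := by positivity
  have hκ : 0 < (a ^ n) ^ 2 / D := by positivity
  refine ⟨√((a ^ n) ^ 2 / D), Real.sqrt_pos.2 hκ, ?_, ?_⟩
  · refine Real.sqrt_le_one.2 ?_
    rw [div_le_one hDpos, hD]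
    have : 0 ≤ 3 / (2 * lam₀) + (b ^ n) ^ 2 := by positivity
    linarith
  · intro q lam w h hq hq1 hlam hs hle hex r hr
    have hlam0 : 0 < lam := hlam₀.trans_le hlam
    have h1 := hs.le_energy ha hq hlam0.le hle hex r hr
    rw [Real.sq_sqrt hκ.le, div_le_iff₀ hDpos]
    have hc : 0 < lam / (q + 2) := by positivity
    have h2 : (a ^ n) ^ 2 ≤ (q + 2) / (2 * lam) * h r ^ 2 + (b ^ n) ^ 2 * w r ^ 2 := by
      have h3 : lam / (q + 2) * ((q + 2) / (2 * lam) * h r ^ 2 + (b ^ n) ^ 2 * w r ^ 2) =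
          h r ^ 2 / 2 + (b ^ n) ^ 2 * (lam / (q + 2)) * w r ^ 2 := by
        field_simp
      refine le_of_mul_le_mul_left ?_ hc
      rw [h3]; linarith
    have h4 : (q + 2) / (2 * lam) ≤ 3 / (2 * lam₀) :=
      div_le_div₀ (by norm_num) (by linarith) (by positivity) (by linarith)
    have h5 : 0 ≤ 3 / (2 * lam₀) := by positivity
    have h6 := mul_le_mul_of_nonneg_right h4 (sq_nonneg (h r))
    have h7 : 0 ≤ (3 / (2 * lam₀) + (a ^ n) ^ 2) * w r ^ 2 := by positivity
    have h8 : 0 ≤ ((b ^ n) ^ 2 + (a ^ n) ^ 2) * h r ^ 2 := by positivity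
    rw [hD]
    linarith

/-! ### Convergence of the eigenvalue parameter -/

section Limit

variable {N : ℕ} {a b : ℝ}

/-- As `|w| ≤ 1`, the potential is at most `lam`, so `m π ≤ Θ lam b`; strict monotonicity in the
potential concludes. -/
theorem IsNormalizedNodal.eigenvalue_le (ha : 0 < a) (hab : a < b) {m : ℕ} {p lam₀ lam : ℝ}
    (hp : 1 < p) (hlam : 0 ≤ lam) {w h θ : ℝ → ℝ} (hw : IsNormalizedNodal N a b m p lam w h θ)
    {Θ : ℝ → ℝ → ℝ} (hΘ : ∀ μ, IsPruferAngle a b (fun r => r ^ (N - 1)) (fun _ => μ) (Θ μ))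
    (hm : Θ lam₀ b = m * Real.pi) : lam₀ ≤ lam := by
  have hP : ContinuousOn (fun r : ℝ => r ^ (N - 1)) (Icc a b) := (continuous_pow _).continuousOn
  have hpos := pow_pos_of_mem_Icc (b := b) (N - 1) ha
  by_contra! hlt
  have h1 := (hΘ lam).right_lt_right hab hP hpos (hΘ lam₀) hlt
  have h2 := IsPruferAngle.le_of_le hab.le hP hpos
    (continuousOn_const.mul ((continuous_abs_rpow (by linarith)).comp_continuousOn
      hw.system.continuousOn_fst)) hw.angle (hΘ lam) (fun t ht => by
        have := Real.rpow_le_one (abs_nonneg _) (hw.abs_le t ht) (show 0 ≤ p - 1 by linarith)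
        exact mul_le_of_le_one_right hlam this) b (right_mem_Icc.2 hab.le)
  rw [hw.angle_right, ← hm] at h2
  linarith

/-- If the eigenvalue parameter of a normalized nodal solution is at least `μ`, then its Prüfer
angle is at least that of the linear problem with potential `μ`, up to `O(p - 1)`. -/
theorem exists_angle_le (ha : 0 < a) (hab : a < b) {μ : ℝ} (hμ : 0 < μ)
    {Θ : ℝ → ℝ} (hΘ : IsPruferAngle a b (fun r => r ^ (N - 1)) (fun _ => μ) Θ) (m : ℕ) :
    ∃ C, ∀ (p lam : ℝ) (w h θ : ℝ → ℝ), 1 < p → p ≤ 2 → μ ≤ lam →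
      IsNormalizedNodal N a b m p lam w h θ → Θ b ≤ m * Real.pi + C * (p - 1) := by
  have hP : ContinuousOn (fun r : ℝ => r ^ (N - 1)) (Icc a b) := (continuous_pow _).continuousOn
  have hpos := pow_pos_of_mem_Icc (b := b) (N - 1) ha
  have hb := right_mem_Icc.2 hab.le
  obtain ⟨p₀, p₁, hp₀, hpb⟩ := exists_bounds hab.le hP hpos
  have hp₁ : 0 ≤ p₁ := (hpos b hb).le.trans (hpb b hb).2
  obtain ⟨κ, hκ, hκ1, hκle⟩ := exists_le_sq_add_sq (b := b) (N - 1) ha hμ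
  refine ⟨p₁ * (μ * κ⁻¹) * Real.exp ((1 / p₀ + p₁ * μ + 1) * (b - a)), ?_⟩
  intro p lam w h θ hp hp2 hlam hw
  have hq : 0 < p - 1 := by linarith
  have hc : ContinuousOn (fun r => lam * |w r| ^ (p - 1)) (Icc a b) :=
    continuousOn_const.mul ((continuous_abs_rpow hq).comp_continuousOn hw.system.continuousOn_fst)
  obtain ⟨S, hS, hSw⟩ := hw.system.exists_eq_mul_sin hab.le hP hpos hc hw.angle hw.left hw.left_pos
  have hSκ : ∀ t ∈ Icc a b, κ ≤ S t := by
    intro t ht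
    have h1 := hκle (p - 1) lam w h hq (by linarith) hlam hw.system hw.abs_le hw.exists_abs_eq t ht
    rw [(hSw t ht).1, (hSw t ht).2] at h1
    have h2 : (S t * Real.sin (θ t)) ^ 2 + (S t * Real.cos (θ t)) ^ 2 = S t ^ 2 := by
      rw [mul_pow, mul_pow, ← mul_add, Real.sin_sq_add_cos_sq, mul_one]
    rw [h2] at h1
    exact (sq_le_sq₀ hκ.le (hS t).le).1 h1
  -- The linear angle comes first, so the Grönwall rate involves only `μ` and the constant does not
  -- depend on `lam`.
  have h1 := hΘ.le_add hw.angle hp₀ hpb (k := μ) (fun _ _ => (abs_of_pos hμ).le)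
    (δ := p₁ * (μ * κ⁻¹ * (p - 1))) (by positivity) (fun t ht => ?_) b hb
  · rw [hw.angle_right] at h1
    linarith
  · set s := |Real.sin (θ t)| with hs
    have hs0 : 0 ≤ s := abs_nonneg _
    have hs1 : s ≤ 1 := Real.abs_sin_le_one _
    have hwt : κ * s ≤ |w t| := by
      rw [(hSw t ht).1, abs_mul, abs_of_pos (hS t)]
      exact mul_le_mul_of_nonneg_right (hSκ t ht) hs0
    have h2 : μ * (κ * s) ^ (p - 1) ≤ lam * |w t| ^ (p - 1) :=
      mul_le_mul hlam (Real.rpow_le_rpow (by positivity) hwt hq.le) (by positivity)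
        (hμ.le.trans hlam)
    obtain ⟨h3, h4⟩ := mul_one_sub_rpow_le (show 0 ≤ κ * s by positivity)
      (mul_le_one₀ hκ1 hs0 hs1) hq
    rw [← sq_abs (Real.sin (θ t)), ← hs, mul_assoc]
    -- One factor `s` is paired with the defect `1 - (κ s) ^ (p - 1)` to gain `p - 1`; the other is
    -- bounded by `1`.
    have h5 : (μ - lam * |w t| ^ (p - 1)) * s ^ 2 ≤ μ * κ⁻¹ * (p - 1) := by
      calc (μ - lam * |w t| ^ (p - 1)) * s ^ 2
          ≤ (μ * (1 - (κ * s) ^ (p - 1))) * s ^ 2 := by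
            refine mul_le_mul_of_nonneg_right ?_ (sq_nonneg _)
            linarith
        _ = μ * κ⁻¹ * s * ((κ * s) * (1 - (κ * s) ^ (p - 1))) := by field_simp
        _ ≤ μ * κ⁻¹ * 1 * (p - 1) :=
            mul_le_mul (mul_le_mul_of_nonneg_left hs1 (by positivity)) h4 h3 (by positivity)
        _ = _ := by ring
    exact (mul_le_mul_of_nonneg_left h5 (hpos t ht).le).trans
      (mul_le_mul_of_nonneg_right (hpb t ht).2 (by positivity))

theorem tendsto_eigenvalue_parameter (ha : 0 < a) (hab : a < b) {m : ℕ} {lam₀ : ℝ}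
    (hlam₀ : 0 < lam₀) {Θ : ℝ → ℝ → ℝ}
    (hΘ : ∀ μ, IsPruferAngle a b (fun r => r ^ (N - 1)) (fun _ => μ) (Θ μ))
    (hm : Θ lam₀ b = m * Real.pi) {lam : ℝ → ℝ} {w h θ : ℝ → ℝ → ℝ} (hlam : ∀ p, 1 < p → 0 ≤ lam p)
    (hw : ∀ p, 1 < p → IsNormalizedNodal N a b m p (lam p) (w p) (h p) (θ p)) :
    Tendsto lam (𝓝[>] 1) (𝓝 lam₀) := by
  have hP : ContinuousOn (fun r : ℝ => r ^ (N - 1)) (Icc a b) := (continuous_pow _).continuousOn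
  have hpos := pow_pos_of_mem_Icc (b := b) (N - 1) ha
  refine tendsto_order.2 ⟨fun μ hμ => ?_, fun μ hμ => ?_⟩
  · filter_upwards [self_mem_nhdsWithin] with p hp
    exact hμ.trans_le ((hw p hp).eigenvalue_le ha hab hp (hlam p hp) hΘ hm)
  · obtain ⟨C, hC⟩ := exists_angle_le ha hab (hlam₀.trans hμ) (hΘ μ) m
    have hlt := (hΘ lam₀).right_lt_right hab hP hpos (hΘ μ) hμ
    rw [hm] at hlt
    have hlim : Tendsto (fun p : ℝ => m * Real.pi + C * (p - 1)) (𝓝[>] 1) (𝓝 (m * Real.pi)) := by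
      have h1 : Continuous fun p : ℝ => m * Real.pi + C * (p - 1) := by fun_prop
      have h2 := h1.tendsto 1
      simp only [sub_self, mul_zero, add_zero] at h2
      exact h2.mono_left nhdsWithin_le_nhds
    filter_upwards [hlim.eventually_lt_const hlt, Ioo_mem_nhdsGT (one_lt_two (α := ℝ))]
      with p h1 hp
    by_contra! hcon
    exact absurd (hC p (lam p) _ _ _ hp.1 hp.2.le hcon (hw p hp.1)) (not_le.2 h1)

end Limit

/-! ### Convergence of the normalized solutions -/

section Convergence

variable {N : ℕ} {a b : ℝ}

lemma abs_nonlinearity_sub_le {q lam lam₀ w : ℝ} (hq : 0 < q) (hlam : 0 ≤ lam) (hw : |w| ≤ 1) :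
    |lam * |w| ^ q * w - lam₀ * w| ≤ |lam - lam₀| + lam * q := by
  obtain ⟨h1, h2⟩ := mul_one_sub_rpow_le (abs_nonneg w) hw hq
  have e : lam * |w| ^ q * w - lam₀ * w = (lam - lam₀) * w - lam * (w * (1 - |w| ^ q)) := by ring
  have h3 : |w * (1 - |w| ^ q)| = |w| * (1 - |w| ^ q) := by
    rw [abs_mul, abs_of_nonneg (sub_nonneg.2 (Real.rpow_le_one (abs_nonneg w) hw hq.le))]
  rw [e]
  refine (abs_sub _ _).trans (add_le_add ?_ ?_)
  · rw [abs_mul]; exact mul_le_of_le_one_right (abs_nonneg _) hw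
  · rw [abs_mul, abs_of_nonneg hlam, h3]; exact mul_le_mul_of_nonneg_left h2 hlam

theorem exists_abs_sub_le (ha : 0 < a) (hab : a < b) {lam₀ : ℝ} {ψ g : ℝ → ℝ}
    (hψ : IsSturmSystem a b (fun r => r ^ (N - 1)) (fun _ => lam₀) ψ g) (hψa : ψ a = 0)
    (hga : 0 < g a) (hψle : ∀ r ∈ Icc a b, |ψ r| ≤ 1) (hψex : ∃ r ∈ Icc a b, |ψ r| = 1) :
    ∃ K, 0 ≤ K ∧ ∀ (m : ℕ) (p lam : ℝ) (w h θ : ℝ → ℝ), 1 < p → 0 ≤ lam →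
      IsNormalizedNodal N a b m p lam w h θ → ∀ r ∈ Icc a b,
        |w r - ψ r| ≤ K * (|lam - lam₀| + lam * (p - 1)) ∧
        |h r - g r| ≤ K * (|lam - lam₀| + lam * (p - 1)) := by
  have hP : ContinuousOn (fun r : ℝ => r ^ (N - 1)) (Icc a b) := (continuous_pow _).continuousOn
  have hpos := pow_pos_of_mem_Icc (b := b) (N - 1) ha
  obtain ⟨p₀, p₁, hp₀, hpb⟩ := exists_bounds hab.le hP hpos
  have hb := right_mem_Icc.2 hab.le
  have hp₁ : 0 ≤ p₁ := (hpos b hb).le.trans (hpb b hb).2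
  obtain ⟨G, hG0, hG⟩ := exists_abs_bound hψ.continuousOn_snd
  set E := Real.exp ((1 / p₀ + p₁ * |lam₀| + 2) * (b - a)) with hE
  -- The stability error, plus the deviation of the multiple `α` from `1` times `|ψ| ≤ 1` or `|g| ≤
  -- G`.
  refine ⟨p₁ * √E * (2 + G), by positivity, ?_⟩
  intro m p lam w h θ hp hlam hw
  set δ := |lam - lam₀| + lam * (p - 1) with hδ
  have hq : 0 < p - 1 := by linarith
  have hδ0 : 0 ≤ δ := by positivity
  -- The multiple of `ψ` with the same Cauchy data at `a` as `w`.
  set α := h a / g a with hα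
  have hα0 : 0 < α := div_pos hw.left_pos hga
  have hsq := sq_add_sq_le_of_sturm_perturbation (P := fun r => r ^ (N - 1)) (c := fun _ => lam₀)
    (z := fun r => w r - α * ψ r) (h := fun r => h r - α * g r)
    (e := fun r => -(r ^ (N - 1) * (lam * |w r| ^ (p - 1) * w r - lam₀ * w r))) (δ := p₁ * δ)
    hp₀ hpb (k := |lam₀|) (fun _ _ => le_rfl)
    (fun r hr => ((hw.system.deriv_fst r hr).sub ((hψ.const_mul α).deriv_fst r hr)).congr_deriv
      (by ring))
    (fun r hr => ((hw.system.deriv_snd r hr).sub ((hψ.const_mul α).deriv_snd r hr)).congr_deriv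
      (by ring))
    (fun r hr => by
      rw [abs_neg, abs_mul, abs_of_pos (hpos r hr)]
      exact mul_le_mul (hpb r hr).2 (abs_nonlinearity_sub_le hq hlam (hw.abs_le r hr))
        (abs_nonneg _) hp₁)
    (by simp [hw.left, hψa]) (by simp [hα, hga.ne'])
  set η := p₁ * δ * √E with hη
  have hη0 : 0 ≤ η := by positivity
  have hbound : ∀ r ∈ Icc a b, |w r - α * ψ r| ≤ η ∧ |h r - α * g r| ≤ η := by
    intro r hr
    have h1 := hsq r hr
    have h2 : Real.exp ((1 / p₀ + p₁ * |lam₀| + 2) * (r - a)) ≤ E := by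
      rw [hE]
      have := hr.2
      gcongr
    have h3 : η ^ 2 = (p₁ * δ) ^ 2 * E := by
      rw [hη, mul_pow, Real.sq_sqrt (Real.exp_pos _).le]
    have h4 : (w r - α * ψ r) ^ 2 + (h r - α * g r) ^ 2 ≤ η ^ 2 := by
      rw [h3]; exact h1.trans (mul_le_mul_of_nonneg_left h2 (sq_nonneg _))
    constructor
    · exact abs_le_of_sq_le_sq (by nlinarith [sq_nonneg (h r - α * g r)]) hη0
    · exact abs_le_of_sq_le_sq (by nlinarith [sq_nonneg (w r - α * ψ r)]) hη0
  -- Both `w` and `ψ` have sup norm `1`: evaluation where `|w| = 1` bounds `α` below, and where `|ψ|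
  -- = 1` above.
  have hα1 : |α - 1| ≤ η := by
    obtain ⟨s, hs, hs1⟩ := hw.exists_abs_eq
    obtain ⟨t, ht, ht1⟩ := hψex
    have h1 := abs_sub_abs_le_abs_sub (w s) (α * ψ s)
    have h2 : |α * ψ s| ≤ α := by
      rw [abs_mul, abs_of_pos hα0]; exact mul_le_of_le_one_right hα0.le (hψle s hs)
    have h3 := abs_sub_abs_le_abs_sub (α * ψ t) (w t)
    have h4 : |α * ψ t| = α := by rw [abs_mul, abs_of_pos hα0, ht1, mul_one]
    rw [abs_sub_comm] at h3
    have h5 := (hbound s hs).1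
    have h6 := (hbound t ht).1
    have h7 := hw.abs_le t ht
    rw [abs_le]
    constructor <;> linarith
  have hK : p₁ * √E * (2 + G) * δ = η * (2 + G) := by rw [hη]; ring
  rw [hK]
  intro r hr
  constructor
  · have e : w r - ψ r = (w r - α * ψ r) + (α - 1) * ψ r := by ring
    rw [e]
    refine (abs_add_le _ _).trans ?_
    rw [abs_mul]
    have h1 := (hbound r hr).1
    have h2 := mul_le_mul hα1 (hψle r hr) (abs_nonneg _) hη0
    nlinarith
  · have e : h r - g r = (h r - α * g r) + (α - 1) * g r := by ring
    rw [e]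
    refine (abs_add_le _ _).trans ?_
    rw [abs_mul]
    have h1 := (hbound r hr).2
    have h2 := mul_le_mul hα1 (hG r hr) (abs_nonneg _) hη0
    nlinarith

/-- Control of the difference in `C²`. -/
theorem exists_norm_iteratedFDeriv_sub_le (ha : 0 < a) (hab : a < b) {lam₀ : ℝ} {ψ g : ℝ → ℝ}
    (hψ : IsSturmSystem a b (fun r => r ^ (N - 1)) (fun _ => lam₀) ψ g) (hψa : ψ a = 0)
    (hga : 0 < g a) (hψle : ∀ r ∈ Icc a b, |ψ r| ≤ 1) (hψex : ∃ r ∈ Icc a b, |ψ r| = 1) :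
    ∃ C, ∀ (m : ℕ) (p lam : ℝ) (w h θ : ℝ → ℝ), 1 < p → 0 ≤ lam →
      IsNormalizedNodal N a b m p lam w h θ → ∀ x ∈ annulus N a b, ∀ k ≤ 2,
        ‖iteratedFDeriv ℝ k (radialLift N fun r => w r - ψ r) x‖ ≤
          C * (|lam - lam₀| + lam * (p - 1)) := by
  obtain ⟨K, hK0, hK⟩ := exists_abs_sub_le ha hab hψ hψa hga hψle hψex
  set n := N - 1
  have hA : 0 < a ^ n := pow_pos ha n
  -- The summands control the differences of the profiles, of first derivatives, and of second
  -- derivatives read off from the equations.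
  refine ⟨K + (1 + 2 / a) * (K / a ^ n) + (1 + |lam₀| * K + n / a * (K / a ^ n)), ?_⟩
  intro m p lam w h θ hp hlam hw x hx k hk
  set δ := |lam - lam₀| + lam * (p - 1) with hδ
  have hq : 0 < p - 1 := by linarith
  have hδ0 : 0 ≤ δ := by positivity
  have hx' : ‖x‖ ∈ Icc a b := ⟨hx.1.le, hx.2.le⟩
  have hr0 : 0 < ‖x‖ := ha.trans hx.1
  refine (norm_iteratedFDeriv_radialLift_le ha
    (fun r hr => (hw.system.hasDerivAt ha hr).1.sub (hψ.hasDerivAt ha hr).1)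
    (fun r hr => (hw.system.hasDerivAt ha hr).2.sub (hψ.hasDerivAt ha hr).2) hx hk).trans ?_
  obtain ⟨h1, h2⟩ := hK m p lam w h θ hp hlam hw ‖x‖ hx'
  have h3 : |h ‖x‖ / ‖x‖ ^ n - g ‖x‖ / ‖x‖ ^ n| ≤ K / a ^ n * δ := by
    rw [← sub_div, abs_div, abs_of_pos (pow_pos hr0 n)]
    calc |h ‖x‖ - g ‖x‖| / ‖x‖ ^ n ≤ K * δ / a ^ n :=
          div_le_div₀ (by positivity) h2 hA (pow_le_pow_left₀ ha.le hx.1.le n)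
      _ = _ := by ring
  have h4 := abs_nonlinearity_sub_le (lam₀ := lam₀) hq hlam (hw.abs_le _ hx')
  have h5 : |-(lam * |w ‖x‖| ^ (p - 1) * w ‖x‖) - n / ‖x‖ * (h ‖x‖ / ‖x‖ ^ n) -
      (-(lam₀ * ψ ‖x‖) - n / ‖x‖ * (g ‖x‖ / ‖x‖ ^ n))| ≤
      δ + |lam₀| * (K * δ) + n / a * (K / a ^ n * δ) := by
    have e : -(lam * |w ‖x‖| ^ (p - 1) * w ‖x‖) - n / ‖x‖ * (h ‖x‖ / ‖x‖ ^ n) -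
      (-(lam₀ * ψ ‖x‖) - n / ‖x‖ * (g ‖x‖ / ‖x‖ ^ n)) =
      -(lam * |w ‖x‖| ^ (p - 1) * w ‖x‖ - lam₀ * w ‖x‖) + -(lam₀ * (w ‖x‖ - ψ ‖x‖)) +
        -(n / ‖x‖ * (h ‖x‖ / ‖x‖ ^ n - g ‖x‖ / ‖x‖ ^ n)) := by ring
    rw [e]
    refine (abs_add_three _ _ _).trans ?_
    rw [abs_neg, abs_neg, abs_neg, abs_mul, abs_mul, abs_div, abs_norm, Nat.abs_cast]
    have h6 : (n : ℝ) / ‖x‖ ≤ n / a := div_le_div_of_nonneg_left (by positivity) ha hx.1.le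
    exact add_le_add (add_le_add h4 (mul_le_mul_of_nonneg_left h1 (abs_nonneg _)))
      (mul_le_mul h6 h3 (abs_nonneg _) (by positivity))
  have h7 := mul_le_mul_of_nonneg_left h3 (show 0 ≤ 1 + 2 / a by positivity)
  rw [← hδ] at h1
  refine (add_le_add (add_le_add h1 h7) h5).trans (le_of_eq ?_)
  ring

end Convergence

theorem proposition2 (N : ℕ) (hN : 2 ≤ N) (a b : ℝ) (ha : 0 < a) (hab : a < b)
    (m : ℕ) (hm : 1 ≤ m)
    (v : ℝ → ℝ → ℝ) (hv : ∀ p : ℝ, 1 < p → IsRadialNodalSolution N a b m p (v p))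
    (lam : ℝ) (hlam : IsRadialEigenvalueNumber N a b m lam)
    (ψ : ℝ → ℝ) (hψ : IsRadialEigenfunction N a b lam ψ)
    (hψ_norm : supNormOn (annulus N a b) (radialLift N ψ) = 1)
    (hψ_sign : 0 < derivWithin ψ (Icc a b) a) :
    Tendsto (fun p : ℝ => supNormOn (annulus N a b) (radialLift N (v p)) ^ (p - 1))
      (𝓝[>] 1) (𝓝 lam) ∧
    TendstoInC2
      (fun (p : ℝ) (x : EuclideanSpace ℝ (Fin N)) =>
        radialLift N (v p) x / supNormOn (annulus N a b) (radialLift N (v p)))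
      (radialLift N ψ) (𝓝[>] 1) (annulus N a b) := by
  have hP : ContinuousOn (fun r : ℝ => r ^ (N - 1)) (Icc a b) := (continuous_pow _).continuousOn
  have hpos := pow_pos_of_mem_Icc (b := b) (N - 1) ha
  have hΘ : ∀ μ : ℝ, ∃ θ, IsPruferAngle a b (fun r => r ^ (N - 1)) (fun _ => μ) θ := fun μ =>
    exists_isPruferAngle hab.le hP hpos continuousOn_const
  choose Θ hΘ using hΘ
  obtain ⟨hlam0, hΘm⟩ := hlam.angle_eq hN ha hab hΘ
  choose! h θ hw using fun p hp => ((hv p hp).exists_isNormalizedNodal hN ha hab hp).2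
  set M : ℝ → ℝ := fun p => supNormOn (annulus N a b) (radialLift N (v p)) with hMdef
  have hM : ∀ p, 1 < p → 0 < M p := fun p hp =>
    ((hv p hp).exists_isNormalizedNodal hN ha hab hp).1
  have hMp : ∀ p, 1 < p → 0 ≤ M p ^ (p - 1) := fun p hp => Real.rpow_nonneg (hM p hp).le _
  have hlim : Tendsto (fun p => M p ^ (p - 1)) (𝓝[>] 1) (𝓝 lam) :=
    tendsto_eigenvalue_parameter ha hab hlam0 hΘ hΘm hMp hw
  refine ⟨hlim, fun k hk => ?_⟩
  obtain ⟨hψa, hψb, g, hg⟩ := hψ.solves.exists_isSturmSystem (γ := fun _ => lam) (by omega) ha hab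
    continuous_const
  obtain ⟨hψle, hψex⟩ := supNormOn_radialLift hN ha hab hg.continuousOn_fst hψa hψb
  rw [hψ_norm] at hψle hψex
  obtain ⟨C, hC⟩ := exists_norm_iteratedFDeriv_sub_le ha hab hg hψa
    (hg.left_pos hab (hpos a (left_mem_Icc.2 hab.le)) hψ_sign) hψle hψex
  have hlim' : Tendsto (fun p => C * (|M p ^ (p - 1) - lam| + M p ^ (p - 1) * (p - 1)))
      (𝓝[>] 1) (𝓝 0) := by
    have h1 : Tendsto (fun p : ℝ => p - 1) (𝓝[>] 1) (𝓝 (1 - 1)) :=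
      ((continuous_id.sub continuous_const).tendsto 1).mono_left nhdsWithin_le_nhds
    have h2 := (((hlim.sub_const lam).abs).add (hlim.mul h1)).const_mul C
    simpa using h2
  rw [Metric.tendstoUniformlyOn_iff]
  intro ε hε
  filter_upwards [hlim'.eventually_lt_const hε, self_mem_nhdsWithin] with p hp hp1 x hx
  refine lt_of_le_of_lt ?_ hp
  have hk' : (k : WithTop ℕ∞) ≤ 2 := by exact_mod_cast hk
  have hnhds := (isOpen_annulus N a b).mem_nhds hx
  have hc1 : ContDiffAt ℝ k (fun x => radialLift N (v p) x / M p) x :=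
    (((hv p hp1).solves.contDiffOn.contDiffAt hnhds).div_const _).of_le hk'
  have hc2 : ContDiffAt ℝ k (radialLift N ψ) x := (hψ.solves.contDiffOn.contDiffAt hnhds).of_le hk'
  have hfun : (fun x => radialLift N (v p) x / M p) - radialLift N ψ =
      radialLift N fun r => (M p)⁻¹ * v p r - ψ r := by
    ext y
    show v p ‖y‖ / M p - ψ ‖y‖ = (M p)⁻¹ * v p ‖y‖ - ψ ‖y‖
    rw [div_eq_inv_mul]
  rw [dist_comm, dist_eq_norm, ← iteratedFDeriv_sub_apply hc1 hc2, hfun]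
  exact hC m p _ _ _ _ hp1 (hMp p hp1) (hw p hp1) x hx k hk
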